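/- Let $\Omega$ be a compact metric space with a continuous flow $\sigma\colon\mathbb{R}\times\Omega\to\Omega$, $(t,\omega)\mapsto\omega\cdot t$, and let $f\colon\Omega\times\mathbb{R}\to\mathbb{R}$ be jointly continuous, with $f_x$ existing and jointly continuous. Let $t\mapsto u(t,\omega,x_0)$ be the maximal solution of $x'=f(\omega\cdot t,x)$, $x(0)=x_0$, and let $\tau(t,\omega,x_0)=(\omega\cdot t,u(t,\omega,x_0))$ be the induced local flow on $\Omega\times\mathbb{R}$. Let $m$ be a $\sigma$-ergodic Borel probability measure on $\Omega$, and let $\mathcal{K}\subset\Omega\times\mathbb{R}$ be a compact $\tau$-invariant set (that is, a compact union of globally defined $\tau$-orbits) which projects onto $\Omega$. Put $J=[\inf_{(\omega,x)\in\mathcal{K}}x,\ \sup_{(\omega,x)\in\mathcal{K}}x]$, let $l(J)$ be its length, and for $0<\epsilon\le l(J)/2$ put $$b_{J,\epsilon}(\omega)=\frac{\epsilon}{4\,l(J)^2}\min\bigl\{2f_x(\omega,x)-f_x(\omega,x-\epsilon/2)-f_x(\omega,x+\epsilon/2)\colon\ [x-\epsilon/2,x+\epsilon/2]\subseteq J\bigr\}.$$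 Assume that $f$ is strictly d-concave with respect to $m$ on $J$: $f_x(\omega,\cdot)$ is concave on $\mathbb{R}$ for every $\omega\in\Omega$, and there is $\rho>0$ such that $m(\{\omega\in\Omega\colon b_{J,\epsilon}(\omega)>0\})>\rho$ for all $\epsilon\in(0,l(J)/2]$. Then there exist at most three distinct $\tau$-ergodic Borel probability measures concentrated on $\mathcal{K}$ which project onto $m$. Moreover, if there are exactly three such measures, they can be labelled $\nu_1,\nu_2,\nu_3$ in such a way that there are $m$-measurable maps $\beta_1,\beta_2,\beta_3\colon\Omega\to\mathbb{R}$ with graphs contained in $\mathcal{K}$, which are $\tau$-equilibria ($\beta_i(\omega\cdot t)=u(t,\omega,\beta_i(\omega))$ for all $\omega\in\Omega$, $t\in\mathbb{R}$), such that $\int_{\mathcal{K}}g\,d\nu_i=\int_\Omega g(\omega,\beta_i(\omega))\,dm$ for every continuous $g\colon\Omega\times\mathbb{R}\to\mathbb{R}$ and $i\in\{1,2,3\}$, and $\beta_1(\omega)<\beta_2(\omega)<\beta_3(\omega)$ for $m$-almost every $\omega\in\Omega$; and the Lyapunov exponents satisfy $$\int_{\mathcal{K}}f_x\,d\nu_1<0,\qquad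 \int_{\mathcal{K}}f_x\,d\nu_2>0,\qquad \int_{\mathcal{K}}f_x\,d\nu_3<0.$$ -/

import Mathlib

open MeasureTheory Set

noncomputable section

namespace SkewFlow

variable {Ω : Type*}

/-- The partial derivative `f_x(ω, x)` with respect to the real variable. -/
def fx (f : Ω × ℝ → ℝ) (p : Ω × ℝ) : ℝ :=
  deriv (fun y => f (p.1, y)) p.2

/-- `f ∈ C^{0,1}(Ω × ℝ, ℝ)`: `f` is jointly continuous, and `f_x` exists everywhere and is
jointly continuous. -/
def IsC01 [TopologicalSpace Ω] (f : Ω × ℝ → ℝ) : Prop :=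
  Continuous f ∧ (∀ ω x, DifferentiableAt ℝ (fun y => f (ω, y)) x) ∧ Continuous (fx f)

section LocalFlow

variable [TopologicalSpace Ω]

/-- `v` solves `x' = f(ω·t, x)`, `x(0) = x₀`, on the open interval `I ∋ 0`. -/
def IsSolutionOn (σ : Flow ℝ Ω) (f : Ω × ℝ → ℝ) (ω : Ω) (x₀ : ℝ) (v : ℝ → ℝ) (I : Set ℝ) : Prop :=
  IsOpen I ∧ I.OrdConnected ∧ (0 : ℝ) ∈ I ∧ v 0 = x₀ ∧
    ∀ t ∈ I, HasDerivAt v (f (σ t ω, v t)) t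

/-- The domain `I_{ω,x₀}` of the maximal solution: all times reached by some solution. -/
def maxInterval (σ : Flow ℝ Ω) (f : Ω × ℝ → ℝ) (ω : Ω) (x₀ : ℝ) : Set ℝ :=
  {t | ∃ v : ℝ → ℝ, ∃ I : Set ℝ, IsSolutionOn σ f ω x₀ v I ∧ t ∈ I}

open Classical in
/-- The maximal solution `t ↦ u(t, ω, x₀)`. For `f ∈ C^{0,1}` all solutions of an initial value
problem agree on common intervals, so that the value is independent of the choice; outside
`maxInterval` the value is a dummy. -/
def u (σ : Flow ℝ Ω) (f : Ω × ℝ → ℝ) (t : ℝ) (ω : Ω) (x₀ : ℝ) : ℝ :=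
  if h : t ∈ maxInterval σ f ω x₀ then h.choose t else 0

/-- The local skewproduct flow `τ(t, ω, x) = (ω·t, u(t, ω, x))`. -/
def tau (σ : Flow ℝ Ω) (f : Ω × ℝ → ℝ) (t : ℝ) (p : Ω × ℝ) : Ω × ℝ :=
  (σ t p.1, u σ f t p.1 p.2)

/-- `K` is `τ`-invariant: it is composed of globally defined `τ`-orbits. -/
def IsTauInvariant (σ : Flow ℝ Ω) (f : Ω × ℝ → ℝ) (K : Set (Ω × ℝ)) : Prop :=
  ∀ p ∈ K, ∀ t : ℝ, t ∈ maxInterval σ f p.1 p.2 ∧ tau σ f t p ∈ K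

/-- The restriction of `τ` to a `τ`-invariant set. -/
def tauOn {σ : Flow ℝ Ω} {f : Ω × ℝ → ℝ} {K : Set (Ω × ℝ)} (hK : IsTauInvariant σ f K)
    (t : ℝ) (p : K) : K :=
  ⟨tau σ f t p.1, (hK p.1 p.2 t).2⟩

/-- `β : Ω → ℝ` is a `τ`-equilibrium. -/
def IsEquilibrium (σ : Flow ℝ Ω) (f : Ω × ℝ → ℝ) (β : Ω → ℝ) : Prop :=
  ∀ ω t, t ∈ maxInterval σ f ω (β ω) ∧ β (σ t ω) = u σ f t ω (β ω)

end LocalFlow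

/-- `μ` is an ergodic (normalized, invariant) measure for the family of maps `φ t`, `t ∈ ℝ`. -/
def IsErgodicMeasure {X : Type*} [MeasurableSpace X] (φ : ℝ → X → X) (μ : Measure X) : Prop :=
  IsProbabilityMeasure μ ∧
  (∀ t : ℝ, ∀ B : Set X, MeasurableSet B → μ (φ t '' B) = μ B) ∧
  ∀ B : Set X, MeasurableSet B → (∀ t : ℝ, φ t '' B = B) → μ B = 0 ∨ μ B = 1

/-- The `τ`-ergodic measures concentrated on `K` (Borel measures on `K`) projecting onto `m`. -/
def ergodicMeasuresOver [TopologicalSpace Ω] [MeasurableSpace Ω] {σ : Flow ℝ Ω} {f : Ω × ℝ → ℝ}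
    {K : Set (Ω × ℝ)} (hK : IsTauInvariant σ f K) (m : Measure Ω) : Set (Measure K) :=
  {ν | IsErgodicMeasure (tauOn hK) ν ∧ ν.map (fun p : K => p.1.1) = m}

/-- The Lyapunov exponent of `K` with respect to `ν`. -/
def lyapunov [MeasurableSpace Ω] (f : Ω × ℝ → ℝ) {K : Set (Ω × ℝ)} (ν : Measure K) : ℝ :=
  ∫ p : K, fx f p.1 ∂ν

/-- `β` is an `m`-measurable equilibrium with graph contained in `K` which represents `ν`:
`∫_K g dν = ∫_Ω g(ω, β(ω)) dm` for every continuous `g`. Being `m`-measurable means being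
measurable with respect to the `m`-completion of the Borel sets. -/
def Represents [TopologicalSpace Ω] [MeasurableSpace Ω] (σ : Flow ℝ Ω) (f : Ω × ℝ → ℝ)
    (m : Measure Ω) {K : Set (Ω × ℝ)} (β : Ω → ℝ) (ν : Measure K) : Prop :=
  IsEquilibrium σ f β ∧ NullMeasurable β m ∧ (∀ ω, (ω, β ω) ∈ K) ∧
    ∀ g : Ω × ℝ → ℝ, Continuous g → ∫ p : K, g p.1 ∂ν = ∫ ω, g (ω, β ω) ∂m

/-- d-concavity: `f_x(ω, ·)` is concave on `ℝ` for all `ω`. -/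
def IsDC (f : Ω × ℝ → ℝ) : Prop :=
  ∀ ω, ConcaveOn ℝ univ (fun x => fx f (ω, x))

/-- The length `l(J)` of a compact interval. -/
def len (J : Set ℝ) : ℝ := sSup J - sInf J

/-- The standardized `ε`-module of d-concavity `b_{J,ε}` of `f` on the compact interval `J`; the
infimum is a minimum for `f ∈ C^{0,1}` and `0 < ε ≤ l(J)`. -/
def stdModule (f : Ω × ℝ → ℝ) (J : Set ℝ) (ε : ℝ) (ω : Ω) : ℝ :=
  ε / (4 * len J ^ 2) *
    sInf ((fun x => 2 * fx f (ω, x) - fx f (ω, x - ε / 2) - fx f (ω, x + ε / 2)) ''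
      {x | Icc (x - ε / 2) (x + ε / 2) ⊆ J})

/-- `f` is strictly d-concave with respect to `m` on the compact interval `J`. -/
def IsSDCOn [MeasurableSpace Ω] (f : Ω × ℝ → ℝ) (m : Measure Ω) (J : Set ℝ) : Prop :=
  IsDC f ∧ ∃ ρ : ℝ, 0 < ρ ∧ ∀ ε : ℝ, 0 < ε → ε ≤ len J / 2 →
    ENNReal.ofReal ρ < m {ω | 0 < stdModule f J ε ω}

/-- The variation interval `J_K` of a compact set `K`. -/
def variationInterval (K : Set (Ω × ℝ)) : Set ℝ :=
  Icc (sInf (Prod.snd '' K)) (sSup (Prod.snd '' K))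

end SkewFlow

end

/-!
An ergodic measure over `m` disintegrates into probability measures on the fibres. As `τ` preserves
the order of each fibre, the masses of the closed half-lines below and above a point are constant
along its orbit, and ergodicity makes both greater than `1/2` at almost every point. A fibre has at
most one such median, so the measure is carried by the graph of an equilibrium. Ergodicity of `m`
orders any two such equilibria almost everywhere, unless they agree almost everywhere.

For two equilibria `β₁ < β₂`, the segment mean
`M(β₁, β₂) = (f(ω, β₂) - f(ω, β₁)) / (β₂ - β₁)` of `f_x` is the derivative of `log (β₂ - β₁)`
along orbits, so it integrates to `0`. For `β₁ < β₂ < β₃`, concavity of `f_x(ω, ·)` gives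
`f_x(β₁) + M(β₂, β₃) ≤ M(β₁, β₂) + M(β₁, β₃)` and two similar inequalities, strict on a set of
positive measure; integrating them yields the signs of the three exponents. A fourth equilibrium
would make the exponent of the second one both positive and negative.
-/

namespace SkewFlow

open Filter Topology NNReal ProbabilityTheory

section SegmentMean

/-- The mean value of `h` on the segment from `x` to `y`. For `h = F'` it is the divided difference
`(F y - F x) / (y - x)`, and the value `h x` at `y = x` extends that quotient continuously. -/
noncomputable def segmentMean (h : ℝ → ℝ) (x y : ℝ) : ℝ :=
  ∫ t in (0 : ℝ)..1, h ((1 - t) * x + t * y)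

theorem segmentMean_self (h : ℝ → ℝ) (x : ℝ) : segmentMean h x x = h x := by
  simp [segmentMean, ← add_mul]

theorem sub_mul_segmentMean {F h : ℝ → ℝ} (hF : ∀ x, HasDerivAt F (h x) x) (hh : Continuous h)
    (x y : ℝ) : (y - x) * segmentMean h x y = F y - F x := by
  have := intervalIntegral.integral_unitInterval_deriv_eq_sub (z₀ := x) (z₁ := y - x)
    (by fun_prop : Continuous fun t : ℝ => h (x + t • (y - x))).continuousOn fun t _ => hF _
  rw [add_sub_cancel, smul_eq_mul] at this
  rw [← this, segmentMean]
  congr! 4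
  simp only [smul_eq_mul]
  ring

theorem continuous_segmentMean {X : Type*} [TopologicalSpace X] {h : X → ℝ → ℝ} {x y : X → ℝ}
    (hh : Continuous (Function.uncurry h)) (hx : Continuous x) (hy : Continuous y) :
    Continuous fun p => segmentMean (h p) (x p) (y p) := by
  refine intervalIntegral.continuous_parametric_intervalIntegral_of_continuous' ?_ 0 1
  exact hh.comp (by fun_prop : Continuous fun q : X × ℝ => (q.1, (1 - q.2) * x q.1 + q.2 * y q.1))

variable {S : Set ℝ} {h : ℝ → ℝ} {a b c d a' b' c' d' : ℝ}

theorem add_le_add_of_concaveOn (hh : ConcaveOn ℝ S h) (ha : a ∈ S) (hd : d ∈ S) (hb : b ∈ Icc a d)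
    (hsum : b + c = a + d) : h a + h d ≤ h b + h c := by
  rw [← segment_eq_Icc (hb.1.trans hb.2)] at hb
  obtain ⟨p, q, hp, hq, hpq, rfl⟩ := hb
  obtain rfl : c = q • a + p • d := by
    simp only [smul_eq_mul] at hsum ⊢
    linear_combination hsum - (a + d) * hpq
  have h₁ := hh.2 ha hd hp hq hpq
  have h₂ := hh.2 ha hd hq hp (by rwa [add_comm])
  simp only [smul_eq_mul] at h₁ h₂ ⊢
  linear_combination h₁ + h₂ - (h a + h d) * hpq

theorem add_lt_add_of_strictConcaveOn (hh : StrictConcaveOn ℝ S h) (ha : a ∈ S) (hd : d ∈ S)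
    (hb : b ∈ Ioo a d) (hsum : b + c = a + d) : h a + h d < h b + h c := by
  have had := hb.1.trans hb.2
  rw [← openSegment_eq_Ioo had] at hb
  obtain ⟨p, q, hp, hq, hpq, rfl⟩ := hb
  obtain rfl : c = q • a + p • d := by
    simp only [smul_eq_mul] at hsum ⊢
    linear_combination hsum - (a + d) * hpq
  have h₁ := hh.2 ha hd had.ne hp hq hpq
  have h₂ := hh.2 ha hd had.ne hq hp (by rwa [add_comm])
  simp only [smul_eq_mul] at h₁ h₂ ⊢
  linear_combination h₁ + h₂ - (h a + h d) * hpq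

theorem segment_add_le_add (hh : ConcaveOn ℝ S h) (ha : a ∈ S) (ha' : a' ∈ S) (hd : d ∈ S)
    (hd' : d' ∈ S) (hb : b ∈ Icc a d) (hb' : b' ∈ Icc a' d') (hsum : b + c = a + d)
    (hsum' : b' + c' = a' + d') {t : ℝ} (ht : t ∈ Icc (0 : ℝ) 1) :
    h ((1 - t) * a + t * a') + h ((1 - t) * d + t * d') ≤
      h ((1 - t) * b + t * b') + h ((1 - t) * c + t * c') := by
  obtain ⟨hab, hbd⟩ := hb
  obtain ⟨hab', hbd'⟩ := hb'
  have h₀ : 0 ≤ t := ht.1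
  have h₁ : 0 ≤ 1 - t := sub_nonneg.2 ht.2
  exact add_le_add_of_concaveOn hh (hh.1 ha ha' h₁ h₀ (by ring)) (hh.1 hd hd' h₁ h₀ (by ring))
    ⟨by gcongr, by gcongr⟩ (by linear_combination (1 - t) * hsum + t * hsum')

theorem segmentMean_add (hc : Continuous h) (x y x' y' : ℝ) :
    segmentMean h x y + segmentMean h x' y' =
      ∫ t in (0 : ℝ)..1, (h ((1 - t) * x + t * y) + h ((1 - t) * x' + t * y')) :=
  (intervalIntegral.integral_add (Continuous.intervalIntegrable (by fun_prop) _ _)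
    (Continuous.intervalIntegrable (by fun_prop) _ _)).symm

theorem segmentMean_add_le_add (hh : ConcaveOn ℝ S h) (hc : Continuous h) (ha : a ∈ S)
    (ha' : a' ∈ S) (hd : d ∈ S) (hd' : d' ∈ S) (hb : b ∈ Icc a d) (hb' : b' ∈ Icc a' d')
    (hsum : b + c = a + d) (hsum' : b' + c' = a' + d') :
    segmentMean h a a' + segmentMean h d d' ≤ segmentMean h b b' + segmentMean h c c' := by
  rw [segmentMean_add hc, segmentMean_add hc]
  exact intervalIntegral.integral_mono_on zero_le_one
    (Continuous.intervalIntegrable (by fun_prop) _ _)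
    (Continuous.intervalIntegrable (by fun_prop) _ _)
    fun t ht => segment_add_le_add hh ha ha' hd hd' hb hb' hsum hsum' ht

theorem segmentMean_add_lt_add (hh : StrictConcaveOn ℝ S h) (hc : Continuous h) (ha : a ∈ S)
    (ha' : a' ∈ S) (hd : d ∈ S) (hd' : d' ∈ S) (hb : b ∈ Icc a d) (hb' : b' ∈ Icc a' d')
    (hsum : b + c = a + d) (hsum' : b' + c' = a' + d') (hab : a + a' < b + b')
    (hbd : b + b' < d + d') :
    segmentMean h a a' + segmentMean h d d' < segmentMean h b b' + segmentMean h c c' := by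
  rw [segmentMean_add hc, segmentMean_add hc]
  refine intervalIntegral.integral_lt_integral_of_continuousOn_of_le_of_exists_lt zero_lt_one
    (by fun_prop) (by fun_prop) (fun t ht => segment_add_le_add hh.concaveOn ha ha' hd hd' hb hb'
      hsum hsum' (Ioc_subset_Icc_self ht)) ⟨1 / 2, by norm_num, ?_⟩
  exact add_lt_add_of_strictConcaveOn hh
    (hh.1 ha ha' (by norm_num) (by norm_num) (by norm_num))
    (hh.1 hd hd' (by norm_num) (by norm_num) (by norm_num))
    ⟨by linarith, by linarith⟩ (by linarith)

theorem segmentMean_comm (h : ℝ → ℝ) (x y : ℝ) : segmentMean h x y = segmentMean h y x := by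
  have := intervalIntegral.integral_comp_sub_left (a := 0) (b := 1)
    (fun t => h ((1 - t) * y + t * x)) 1
  simp only [sub_self, sub_zero, sub_sub_cancel] at this
  simpa only [segmentMean, add_comm] using this

variable {x₁ x₂ x₃ : ℝ}

theorem segmentMean_triple_le (hh : ConcaveOn ℝ S h) (hc : Continuous h) (h₁ : x₁ ∈ S)
    (h₂ : x₂ ∈ S) (h₃ : x₃ ∈ S) (h₁₂ : x₁ ≤ x₂) (h₂₃ : x₂ ≤ x₃) :
    h x₁ + segmentMean h x₂ x₃ ≤ segmentMean h x₁ x₂ + segmentMean h x₁ x₃ ∧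
      segmentMean h x₁ x₂ + segmentMean h x₂ x₃ ≤ h x₂ + segmentMean h x₁ x₃ ∧
      segmentMean h x₁ x₂ + h x₃ ≤ segmentMean h x₁ x₃ + segmentMean h x₂ x₃ := by
  have h₁₃ := h₁₂.trans h₂₃
  rw [← segmentMean_self h x₁, ← segmentMean_self h x₂, ← segmentMean_self h x₃]
  refine ⟨?_, ?_, ?_⟩
  · rw [segmentMean_comm h x₁ x₂]
    exact segmentMean_add_le_add hh hc h₁ h₁ h₂ h₃ (right_mem_Icc.2 h₁₂) (left_mem_Icc.2 h₁₃)
      (add_comm _ _) rfl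
  · exact segmentMean_add_le_add hh hc h₁ h₂ h₂ h₃ (right_mem_Icc.2 h₁₂) (left_mem_Icc.2 h₂₃)
      (add_comm _ _) rfl
  · rw [segmentMean_comm h x₂ x₃]
    exact segmentMean_add_le_add hh hc h₁ h₂ h₃ h₃ (left_mem_Icc.2 h₁₃) (right_mem_Icc.2 h₂₃)
      rfl (add_comm _ _)

theorem segmentMean_triple_lt (hh : StrictConcaveOn ℝ S h) (hc : Continuous h) (h₁ : x₁ ∈ S)
    (h₂ : x₂ ∈ S) (h₃ : x₃ ∈ S) (h₁₂ : x₁ < x₂) (h₂₃ : x₂ < x₃) :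
    h x₁ + segmentMean h x₂ x₃ < segmentMean h x₁ x₂ + segmentMean h x₁ x₃ ∧
      segmentMean h x₁ x₂ + segmentMean h x₂ x₃ < h x₂ + segmentMean h x₁ x₃ ∧
      segmentMean h x₁ x₂ + h x₃ < segmentMean h x₁ x₃ + segmentMean h x₂ x₃ := by
  have h₁₃ := h₁₂.trans h₂₃
  rw [← segmentMean_self h x₁, ← segmentMean_self h x₂, ← segmentMean_self h x₃]
  refine ⟨?_, ?_, ?_⟩
  · rw [segmentMean_comm h x₁ x₂]
    exact segmentMean_add_lt_add hh hc h₁ h₁ h₂ h₃ (right_mem_Icc.2 h₁₂.le)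
      (left_mem_Icc.2 h₁₃.le) (add_comm _ _) rfl (by linarith) (by linarith)
  · exact segmentMean_add_lt_add hh hc h₁ h₂ h₂ h₃ (right_mem_Icc.2 h₁₂.le)
      (left_mem_Icc.2 h₂₃.le) (add_comm _ _) rfl (by linarith) (by linarith)
  · rw [segmentMean_comm h x₂ x₃]
    exact segmentMean_add_lt_add hh hc h₁ h₂ h₃ h₃ (left_mem_Icc.2 h₁₃.le)
      (right_mem_Icc.2 h₂₃.le) rfl (add_comm _ _) (by linarith) (by linarith)

end SegmentMean

section Trajectories

theorem eq_mul_exp_integral_of_hasDerivAt {a d : ℝ → ℝ} {I : Set ℝ} (hI : IsOpen I)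
    (hIc : I.OrdConnected) (ha : ContinuousOn a I) (hd : ∀ t ∈ I, HasDerivAt d (a t * d t) t)
    {s t : ℝ} (hs : s ∈ I) (ht : t ∈ I) : d t = d s * Real.exp (∫ r in s..t, a r) := by
  have hint (r : ℝ) (hr : r ∈ I) : HasDerivAt (fun r => ∫ q in s..r, a q) (a r) r :=
    intervalIntegral.integral_hasDerivAt_right
      (ha.mono (hIc.uIcc_subset hs hr)).intervalIntegrable
      (ha.stronglyMeasurableAtFilter hI r hr) (ha.continuousAt (hI.mem_nhds hr))
  have hconst (r : ℝ) (hr : r ∈ I) :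
      HasDerivAt (fun r => d r * Real.exp (-∫ q in s..r, a q)) 0 r :=
    ((hd r hr).fun_mul (hint r hr).fun_neg.exp).congr_deriv (by ring)
  have := hI.is_const_of_deriv_eq_zero hIc.isPreconnected
    (fun r hr => (hconst r hr).differentiableAt.differentiableWithinAt)
    (fun r hr => (hconst r hr).deriv) ht hs
  simp only [intervalIntegral.integral_same, neg_zero, Real.exp_zero, mul_one] at this
  rw [← this, mul_assoc, ← Real.exp_add, neg_add_cancel, Real.exp_zero, mul_one]

variable {Ω : Type*} [TopologicalSpace Ω] {σ : Flow ℝ Ω} {f : Ω × ℝ → ℝ}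

theorem IsC01.continuous_segmentMean {X : Type*} [TopologicalSpace X] (hf : IsC01 f) {ω : X → Ω}
    {x y : X → ℝ} (hω : Continuous ω) (hx : Continuous x) (hy : Continuous y) :
    Continuous fun p => segmentMean (fun z => fx f (ω p, z)) (x p) (y p) :=
  SkewFlow.continuous_segmentMean (hf.2.2.comp (by fun_prop)) hx hy

theorem IsC01.sub_mul_segmentMean (hf : IsC01 f) (ω : Ω) (x y : ℝ) :
    (y - x) * segmentMean (fun z => fx f (ω, z)) x y = f (ω, y) - f (ω, x) :=
  SkewFlow.sub_mul_segmentMean (F := fun z => f (ω, z)) (h := fun z => fx f (ω, z))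
    (fun z => (hf.2.1 ω z).hasDerivAt) (hf.2.2.comp (by fun_prop)) x y

theorem solution_sub_eq (hf : IsC01 f) {ω : Ω} {v w : ℝ → ℝ} {I : Set ℝ} (hI : IsOpen I)
    (hIc : I.OrdConnected) (hv : ∀ t ∈ I, HasDerivAt v (f (σ t ω, v t)) t)
    (hw : ∀ t ∈ I, HasDerivAt w (f (σ t ω, w t)) t) {s t : ℝ} (hs : s ∈ I) (ht : t ∈ I) :
    w t - v t = (w s - v s) *
      Real.exp (∫ r in s..t, segmentMean (fun x => fx f (σ r ω, x)) (v r) (w r)) := by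
  refine eq_mul_exp_integral_of_hasDerivAt (d := fun t => w t - v t) hI hIc ?_ (fun r hr => ?_)
    hs ht
  · have hvc : ContinuousOn v I := HasDerivAt.continuousOn hv
    have hwc : ContinuousOn w I := HasDerivAt.continuousOn hw
    have hσ : Continuous fun q : ℝ × ℝ × ℝ => σ q.1 ω :=
      σ.continuous continuous_fst continuous_const
    exact (hf.continuous_segmentMean hσ (continuous_fst.comp continuous_snd)
      (continuous_snd.comp continuous_snd)).comp_continuousOn
      (continuousOn_id.prodMk (hvc.prodMk hwc))
  · rw [mul_comm, hf.sub_mul_segmentMean]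
    exact (hw r hr).sub (hv r hr)

theorem solution_unique (hf : IsC01 f) {ω : Ω} {v w : ℝ → ℝ} {I : Set ℝ} (hI : IsOpen I)
    (hIc : I.OrdConnected) (hv : ∀ t ∈ I, HasDerivAt v (f (σ t ω, v t)) t)
    (hw : ∀ t ∈ I, HasDerivAt w (f (σ t ω, w t)) t) {s : ℝ} (hs : s ∈ I) (h : v s = w s) :
    EqOn v w I := fun t ht => by
  have := solution_sub_eq hf hI hIc hw hv hs ht
  rwa [h, sub_self, zero_mul, sub_eq_zero] at this

theorem IsSolutionOn.u_eq (hf : IsC01 f) {ω : Ω} {x₀ : ℝ} {v : ℝ → ℝ} {I : Set ℝ}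
    (hv : IsSolutionOn σ f ω x₀ v I) {t : ℝ} (ht : t ∈ I) : u σ f t ω x₀ = v t := by
  have hmem : t ∈ maxInterval σ f ω x₀ := ⟨v, I, hv, ht⟩
  rw [u, dif_pos hmem]
  obtain ⟨I', ⟨hI'o, hI'c, h0', hw0, hw⟩, ht'⟩ := hmem.choose_spec
  obtain ⟨hIo, hIc, h0, hv0, hv⟩ := hv
  exact solution_unique hf (hI'o.inter hIo) (hI'c.inter hIc) (fun s hs => hw s hs.1)
    (fun s hs => hv s hs.2) ⟨h0', h0⟩ (hw0.trans hv0.symm) ⟨ht', ht⟩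

theorem u_zero (hf : IsC01 f) {ω : Ω} {x₀ : ℝ} (h : (0 : ℝ) ∈ maxInterval σ f ω x₀) :
    u σ f 0 ω x₀ = x₀ := by
  obtain ⟨v, I, hv, hI⟩ := h
  rw [hv.u_eq hf hI, hv.2.2.2.1]

theorem hasDerivAt_u (hf : IsC01 f) {ω : Ω} {x₀ t : ℝ} (ht : t ∈ maxInterval σ f ω x₀) :
    HasDerivAt (fun s => u σ f s ω x₀) (f (σ t ω, u σ f t ω x₀)) t := by
  obtain ⟨v, I, hv, hI⟩ := ht
  rw [hv.u_eq hf hI]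
  refine (hv.2.2.2.2 t hI).congr_of_eventuallyEq ?_
  filter_upwards [hv.1.mem_nhds hI] with s hs using hv.u_eq hf hs

variable {K : Set (Ω × ℝ)} (hK : IsTauInvariant σ f K)

theorem hasDerivAt_tauOn_snd (hf : IsC01 f) (p : K) (t : ℝ) :
    HasDerivAt (fun s => (tauOn hK s p).1.2) (f (tauOn hK t p).1) t :=
  hasDerivAt_u hf (hK p.1 p.2 t).1

theorem tauOn_zero (hf : IsC01 f) (p : K) : tauOn hK 0 p = p :=
  Subtype.ext <| Prod.ext (σ.map_zero_apply p.1.1) (u_zero hf (hK p.1 p.2 0).1)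

theorem tauOn_add (hf : IsC01 f) (s t : ℝ) (p : K) :
    tauOn hK (s + t) p = tauOn hK s (tauOn hK t p) := by
  refine Subtype.ext <| Prod.ext (σ.map_add s t p.1.1) ?_
  refine solution_unique hf (σ := σ) (ω := σ t p.1.1) (v := fun r => (tauOn hK (r + t) p).1.2)
    (w := fun r => (tauOn hK r (tauOn hK t p)).1.2) isOpen_univ ordConnected_univ (fun r _ => ?_)
    (fun r _ => hasDerivAt_tauOn_snd hK hf _ r) (mem_univ 0) ?_ (mem_univ s)
  · rw [← σ.map_add]
    exact (hasDerivAt_tauOn_snd hK hf p (r + t)).comp_add_const r t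
  · simp only [zero_add, tauOn_zero hK hf]

theorem tauOn_snd_sub (hf : IsC01 f) {p q : K} (hpq : p.1.1 = q.1.1) (t : ℝ) :
    (tauOn hK t q).1.2 - (tauOn hK t p).1.2 = (q.1.2 - p.1.2) * Real.exp (∫ r in 0..t,
      segmentMean (fun x => fx f (σ r p.1.1, x)) (tauOn hK r p).1.2 (tauOn hK r q).1.2) := by
  have hq (r : ℝ) : HasDerivAt (fun s => (tauOn hK s q).1.2)
      (f (σ r p.1.1, (tauOn hK r q).1.2)) r := by
    rw [hpq]
    exact hasDerivAt_tauOn_snd hK hf q r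
  have := solution_sub_eq hf isOpen_univ ordConnected_univ
    (fun r _ => hasDerivAt_tauOn_snd hK hf p r) (fun r _ => hq r) (mem_univ 0) (mem_univ t)
  rwa [tauOn_zero hK hf, tauOn_zero hK hf] at this

theorem tauOn_snd_le_iff (hf : IsC01 f) {p q : K} (hpq : p.1.1 = q.1.1) (t : ℝ) :
    (tauOn hK t p).1.2 ≤ (tauOn hK t q).1.2 ↔ p.1.2 ≤ q.1.2 := by
  rw [← sub_nonneg, tauOn_snd_sub hK hf hpq, mul_nonneg_iff_of_pos_right (Real.exp_pos _),
    sub_nonneg]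

theorem continuous_tauOn_time (hf : IsC01 f) (p : K) : Continuous fun t => tauOn hK t p :=
  ((σ.continuous continuous_id continuous_const).prodMk <| continuous_iff_continuousAt.2 fun t =>
    (hasDerivAt_tauOn_snd hK hf p t).continuousAt).subtype_mk _

end Trajectories

section ContinuousFlow

theorem continuous_gronwallBound (K x : ℝ) :
    Continuous fun p : ℝ × ℝ => gronwallBound p.1 K p.2 x := by
  unfold gronwallBound
  split_ifs <;> fun_prop

variable {Ω : Type*} [TopologicalSpace Ω] {σ : Flow ℝ Ω} {f : Ω × ℝ → ℝ} {K : Set (Ω × ℝ)}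

theorem exists_snd_mem_Icc (hKc : IsCompact K) : ∃ R, ∀ p : K, p.1.2 ∈ Icc (-R) R := by
  obtain ⟨R, hR⟩ := hKc.exists_bound_of_continuousOn continuous_snd.continuousOn
  exact ⟨R, fun p => abs_le.1 (hR p p.2)⟩

theorem IsC01.exists_lipschitzOnWith [CompactSpace Ω] (hf : IsC01 f) (R : ℝ) :
    ∃ L : ℝ≥0, ∀ ω, LipschitzOnWith L (fun x => f (ω, x)) (Icc (-R) R) := by
  obtain ⟨L, hL⟩ := (isCompact_univ.prod (isCompact_Icc (a := -R) (b := R))).bddAbove_image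
    (hf.2.2.nnnorm.continuousOn (s := univ ×ˢ Icc (-R) R))
  exact ⟨L, fun ω => (convex_Icc (-R) R).lipschitzOnWith_of_nnnorm_deriv_le
    (fun x _ => hf.2.1 ω x) fun x hx => hL (mem_image_of_mem _ (mk_mem_prod (mem_univ ω) hx))⟩

variable (hK : IsTauInvariant σ f K)

theorem dist_tauOn_snd_le (hf : IsC01 f) {R : ℝ} (hR : ∀ p : K, p.1.2 ∈ Icc (-R) R) {L : ℝ≥0}
    (hL : ∀ ω, LipschitzOnWith L (fun x => f (ω, x)) (Icc (-R) R)) {p q : K} {t ε : ℝ}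
    (ht : 0 ≤ t) (hε : ∀ r ∈ Icc 0 t, ∀ x ∈ Icc (-R) R,
      dist (f (σ r q.1.1, x)) (f (σ r p.1.1, x)) ≤ ε) :
    dist (tauOn hK t p).1.2 (tauOn hK t q).1.2 ≤ gronwallBound (dist p.1.2 q.1.2) L ε t := by
  have hderiv := hasDerivAt_tauOn_snd hK hf
  have hcont (p : K) : ContinuousOn (fun r => (tauOn hK r p).1.2) (Icc 0 t) :=
    HasDerivAt.continuousOn fun r _ => hderiv p r
  have := dist_le_of_approx_trajectories_ODE_of_mem (v := fun r x => f (σ r p.1.1, x))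
    (s := fun _ => Icc (-R) R) (a := 0) (εf := 0) (fun r _ => hL _)
    (hcont p) (fun r _ => (hderiv p r).hasDerivWithinAt) (fun r _ => (dist_self _).le)
    (fun r _ => hR _) (hcont q) (fun r _ => (hderiv q r).hasDerivWithinAt)
    (fun r hr => hε r (Ico_subset_Icc_self hr) _ (hR (tauOn hK r q))) (fun r _ => hR _) le_rfl t
    (right_mem_Icc.2 ht)
  simpa only [tauOn_zero hK hf, zero_add, sub_zero] using this

theorem continuous_tauOn_of_nonneg [CompactSpace Ω] (hf : IsC01 f) (hKc : IsCompact K) {t : ℝ}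
    (ht : 0 ≤ t) : Continuous (tauOn hK t) := by
  obtain ⟨R, hR⟩ := exists_snd_mem_Icc hKc
  obtain ⟨L, hL⟩ := hf.exists_lipschitzOnWith R
  refine (Continuous.prodMk (σ.continuous continuous_const (by fun_prop))
    (continuous_iff_continuousAt.2 fun p => ?_)).subtype_mk _
  have hcpt : IsCompact (Icc 0 t ×ˢ Icc (-R) R) := isCompact_Icc.prod isCompact_Icc
  let g (q : K) (z : ℝ × ℝ) : ℝ := dist (f (σ z.1 q.1.1, z.2)) (f (σ z.1 p.1.1, z.2))
  have hg : Continuous ↿g := by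
    have hσ : Continuous fun w : K × ℝ × ℝ => σ w.2.1 w.1.1.1 :=
      σ.continuous (by fun_prop) (by fun_prop)
    have hσ' : Continuous fun w : K × ℝ × ℝ => σ w.2.1 p.1.1 :=
      σ.continuous (by fun_prop) (by fun_prop)
    exact (hf.1.comp (hσ.prodMk (by fun_prop))).dist (hf.1.comp (hσ'.prodMk (by fun_prop)))
  have hle (q : K) : dist (tauOn hK t q).1.2 (tauOn hK t p).1.2 ≤
      gronwallBound (dist p.1.2 q.1.2) L (sSup (g q '' (Icc 0 t ×ˢ Icc (-R) R))) t := by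
    rw [dist_comm]
    exact dist_tauOn_snd_le hK hf hR hL ht fun r hr x hx => le_csSup
      (hcpt.bddAbove_image (hg.comp (by fun_prop : Continuous fun z => (q, z))).continuousOn)
      (mem_image_of_mem (g q) (mk_mem_prod hr hx))
  have hbound : Continuous fun q : K =>
      gronwallBound (dist p.1.2 q.1.2) L (sSup (g q '' (Icc 0 t ×ˢ Icc (-R) R))) t :=
    (continuous_gronwallBound L t).comp
      (Continuous.prodMk (by fun_prop) (hcpt.continuous_sSup hg))
  refine tendsto_iff_dist_tendsto_zero.2 (squeeze_zero (fun _ => dist_nonneg) hle ?_)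
  have hsup : sSup (g p '' (Icc 0 t ×ˢ Icc (-R) R)) = 0 := by
    rw [show g p = fun _ => 0 from funext fun z => dist_self _,
      ((nonempty_Icc.2 ht).prod ⟨_, hR p⟩).image_const, csSup_singleton]
  simpa only [hsup, dist_self, gronwallBound_ε0_δ0] using hbound.tendsto p

theorem continuous_tauOn [CompactSpace Ω] [T2Space Ω] (hf : IsC01 f) (hKc : IsCompact K) (t : ℝ) :
    Continuous (tauOn hK t) := by
  rcases le_total 0 t with ht | ht
  · exact continuous_tauOn_of_nonneg hK hf hKc ht
  · have := isCompact_iff_compactSpace.1 hKc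
    let e : K ≃ K :=
      { toFun := tauOn hK (-t)
        invFun := tauOn hK t
        left_inv := fun p => by rw [← tauOn_add hK hf, add_neg_cancel, tauOn_zero hK hf]
        right_inv := fun p => by rw [← tauOn_add hK hf, neg_add_cancel, tauOn_zero hK hf] }
    exact Continuous.continuous_symm_of_equiv_compact_to_t2 (f := e)
      (continuous_tauOn_of_nonneg hK hf hKc (neg_nonneg.2 ht))

end ContinuousFlow

section Coboundary

variable {X Y : Type*} [MeasurableSpace X] [MeasurableSpace Y] {μ : Measure X}

theorem integral_comp_measurePreserving {ν : Measure Y} {T : X → Y} (hT : MeasurePreserving T μ ν)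
    {G : Y → ℝ} (hG : AEStronglyMeasurable G ν) : ∫ x, G (T x) ∂μ = ∫ y, G y ∂ν := by
  rw [← hT.map_eq] at hG ⊢
  exact (integral_map hT.aemeasurable hG).symm

-- `G` itself need not be integrable; its truncations are, and they do not increase `|G ∘ T - G|`.
theorem integral_coboundary_eq_zero [IsFiniteMeasure μ] {T : X → X} (hT : MeasurePreserving T μ μ)
    {G : X → ℝ} (hG : AEStronglyMeasurable G μ) (hi : Integrable (fun x => G (T x) - G x) μ) :
    ∫ x, (G (T x) - G x) ∂μ = 0 := by
  let c (n : ℕ) (x : ℝ) : ℝ := max (-n) (min x n)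
  have hc (n : ℕ) : LipschitzWith 1 (c n) := (LipschitzWith.id.min_const _).const_max _
  have hcG (n : ℕ) : AEStronglyMeasurable (fun x => c n (G x)) μ :=
    (hc n).continuous.comp_aestronglyMeasurable hG
  have hci (n : ℕ) : Integrable (fun x => c n (G x)) μ :=
    Integrable.of_bound (hcG n) n <| ae_of_all _ fun x => abs_le.2
      ⟨le_max_left _ _, max_le (by linarith [n.cast_nonneg (α := ℝ)]) (min_le_right _ _)⟩
  have hzero (n : ℕ) : ∫ x, (c n (G (T x)) - c n (G x)) ∂μ = 0 := by
    have hcT : Integrable (fun x => c n (G (T x))) μ := hT.integrable_comp_of_integrable (hci n)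
    rw [integral_sub hcT (hci n), integral_comp_measurePreserving hT (hcG n), sub_self]
  have hlim (x : ℝ) : ∀ᶠ n : ℕ in atTop, c n x = x := by
    filter_upwards [eventually_ge_atTop ⌈|x|⌉₊] with n hn
    have := abs_le.1 (Nat.ceil_le.1 hn)
    simp only [c, min_eq_left this.2, max_eq_right this.1]
  have := tendsto_integral_of_dominated_convergence (F := fun n x => c n (G (T x)) - c n (G x))
    (fun x => |G (T x) - G x|)
    (fun n => ((hcG n).comp_measurePreserving hT).sub (hcG n)) hi.abs
    (fun n => ae_of_all _ fun x => by simpa [Real.dist_eq] using (hc n).dist_le_mul (G (T x)) (G x))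
    (ae_of_all _ fun x => tendsto_const_nhds.congr' <| by
      filter_upwards [hlim (G (T x)), hlim (G x)] with n h₁ h₂ using by rw [h₁, h₂])
  simp only [hzero] at this
  exact tendsto_nhds_unique this tendsto_const_nhds

end Coboundary

/-- A jointly measurable action of `ℝ`. -/
structure IsMeasurableFlow {X : Type*} [MeasurableSpace X] (φ : ℝ → X → X) : Prop where
  zero : ∀ x, φ 0 x = x
  add : ∀ s t x, φ (s + t) x = φ s (φ t x)
  measurable : Measurable fun z : ℝ × X => φ z.1 z.2

/-- The points whose orbit lies in `B` for almost every time: an exactly invariant substitute for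
an almost invariant set `B`. -/
def orbitCore {X : Type*} (φ : ℝ → X → X) (B : Set X) : Set X :=
  {x | ∀ᵐ t : ℝ, φ t x ∈ B}

namespace IsMeasurableFlow

variable {X : Type*} [MeasurableSpace X] {φ : ℝ → X → X} (hφ : IsMeasurableFlow φ)
  {μ : Measure X} {B : Set X}
include hφ

theorem measurable_time (t : ℝ) : Measurable (φ t) :=
  hφ.measurable.comp (measurable_const.prodMk measurable_id)

theorem neg_apply (t : ℝ) (x : X) : φ (-t) (φ t x) = x := by
  rw [← hφ.add, neg_add_cancel, hφ.zero]

theorem apply_neg (t : ℝ) (x : X) : φ t (φ (-t) x) = x := by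
  rw [← hφ.add, add_neg_cancel, hφ.zero]

theorem image_eq (t : ℝ) (B : Set X) : φ t '' B = φ (-t) ⁻¹' B :=
  congrFun (image_eq_preimage_of_inverse (hφ.neg_apply t) (hφ.apply_neg t)) B

theorem measurableEmbedding (t : ℝ) : MeasurableEmbedding (φ t) where
  injective := Function.LeftInverse.injective (hφ.neg_apply t)
  measurable := hφ.measurable_time t
  measurableSet_image' B hB := hφ.image_eq t B ▸ hφ.measurable_time (-t) hB

theorem measurePreserving (hμ : IsErgodicMeasure φ μ) (t : ℝ) : MeasurePreserving (φ t) μ μ := by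
  refine ⟨hφ.measurable_time t, Measure.ext fun B hB => ?_⟩
  rw [Measure.map_apply (hφ.measurable_time t) hB, ← hμ.2.1 (-t) B hB, hφ.image_eq, neg_neg]

theorem measurableSet_orbitCore (hB : MeasurableSet B) : MeasurableSet (orbitCore φ B) := by
  have hS : MeasurableSet {z : X × ℝ | φ z.2 z.1 ∈ Bᶜ} :=
    (hφ.measurable.comp measurable_swap) hB.compl
  exact (measurable_measure_prodMk_left (ν := (volume : Measure ℝ)) hS)
    (measurableSet_singleton 0)

theorem apply_mem_orbitCore (t : ℝ) {x : X} (hx : x ∈ orbitCore φ B) : φ t x ∈ orbitCore φ B := by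
  filter_upwards [(measurePreserving_add_right volume t).quasiMeasurePreserving.ae hx] with s hs
  rwa [← hφ.add]

theorem image_orbitCore (t : ℝ) : φ t '' orbitCore φ B = orbitCore φ B := by
  rw [hφ.image_eq]
  refine Subset.antisymm (fun x hx => ?_) fun x hx => hφ.apply_mem_orbitCore (-t) hx
  rw [← hφ.apply_neg t x]
  exact hφ.apply_mem_orbitCore t hx

theorem ae_mem_orbitCore_iff [SFinite μ] (hB : MeasurableSet B)
    (h : ∀ t, ∀ᵐ x ∂μ, φ t x ∈ B ↔ x ∈ B) : ∀ᵐ x ∂μ, x ∈ orbitCore φ B ↔ x ∈ B := by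
  have h' : ∀ᵐ x ∂μ, ∀ᵐ t : ℝ, φ t x ∈ B ↔ x ∈ B :=
    (Measure.ae_ae_comm (μ := (volume : Measure ℝ)) (ν := μ)
      ((hφ.measurable hB).iff (measurable_snd hB))).1 (ae_of_all _ h)
  filter_upwards [h'] with x hx
  refine ⟨fun hc => ?_, fun hxB => hx.mono fun t ht => ht.2 hxB⟩
  obtain ⟨t, h₁, h₂⟩ := (hx.and hc).exists
  exact h₁.1 h₂

theorem ae_mem_or_ae_notMem (hμ : IsErgodicMeasure φ μ) (hB : MeasurableSet B)
    (h : ∀ t, ∀ᵐ x ∂μ, φ t x ∈ B ↔ x ∈ B) : (∀ᵐ x ∂μ, x ∈ B) ∨ ∀ᵐ x ∂μ, x ∉ B := by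
  have := hμ.1
  have hcore := hφ.ae_mem_orbitCore_iff hB h
  rcases hμ.2.2 _ (hφ.measurableSet_orbitCore hB) hφ.image_orbitCore with h₀ | h₁
  · right
    filter_upwards [hcore, measure_eq_zero_iff_ae_notMem.1 h₀] with x hx hx' using fun hB =>
      hx' (hx.2 hB)
  · left
    filter_upwards [hcore, (mem_ae_iff_prob_eq_one (hφ.measurableSet_orbitCore hB)).2 h₁]
      with x hx hx' using hx.1 hx'

theorem ae_mem_orbitCore (hμ : IsErgodicMeasure φ μ) (hB : MeasurableSet B)
    (h : ∀ᵐ x ∂μ, x ∈ B) : ∀ᵐ x ∂μ, x ∈ orbitCore φ B := by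
  have := hμ.1
  have hinv (t : ℝ) : ∀ᵐ x ∂μ, φ t x ∈ B ↔ x ∈ B := by
    filter_upwards [h, (hφ.measurePreserving hμ t).quasiMeasurePreserving.ae h] with x h₁ h₂
    exact iff_of_true h₂ h₁
  filter_upwards [h, hφ.ae_mem_orbitCore_iff hB hinv] with x h₁ h₂ using h₂.2 h₁

theorem integral_eq_zero_of_additive_cocycle (hμ : IsErgodicMeasure φ μ) {G D : X → ℝ}
    (hG : AEStronglyMeasurable G μ) (hD : Integrable D μ)
    (hGD : ∀ᵐ x ∂μ, G (φ 1 x) - G x = ∫ t in (0 : ℝ)..1, D (φ t x)) : ∫ x, D x ∂μ = 0 := by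
  have := hμ.1
  have : IsFiniteMeasure (volume.restrict (uIoc (0 : ℝ) 1)) := by
    rw [uIoc_of_le zero_le_one]
    infer_instance
  have hmp := hφ.measurePreserving hμ
  have hskew : MeasurePreserving (fun p : ℝ × X => (p.1, φ p.1 p.2))
      ((volume.restrict (uIoc 0 1)).prod μ) ((volume.restrict (uIoc 0 1)).prod μ) :=
    (MeasurePreserving.id _).skew_product hφ.measurable (ae_of_all _ fun t => (hmp t).map_eq)
  have hint : Integrable (fun p : ℝ × X => D (φ p.1 p.2)) ((volume.restrict (uIoc 0 1)).prod μ) :=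
    hskew.integrable_comp_of_integrable (hD.comp_snd _)
  have hGi : Integrable (fun x => G (φ 1 x) - G x) μ := by
    refine hint.integral_prod_right.congr ?_
    filter_upwards [hGD] with x hx
    rw [hx, intervalIntegral.integral_of_le zero_le_one, uIoc_of_le zero_le_one]
  calc ∫ x, D x ∂μ = ∫ t in (0 : ℝ)..1, ∫ x, D (φ t x) ∂μ := by
        simp [integral_comp_measurePreserving (hmp _) hD.1]
    _ = ∫ x, (∫ t in (0 : ℝ)..1, D (φ t x)) ∂μ := intervalIntegral_integral_swap hint
    _ = ∫ x, (G (φ 1 x) - G x) ∂μ := (integral_congr_ae hGD).symm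
    _ = 0 := integral_coboundary_eq_zero (hmp 1) hG hGi

end IsMeasurableFlow

section ConditionalDistribution

variable {X Y Z : Type*} [MeasurableSpace X] [MeasurableSpace Y] [MeasurableSpace Z]
  {ν : Measure X} [IsFiniteMeasure ν] {π : X → Y} {T : X → X} {S : Y → Y}

theorem condDistrib_ae_eq_comap [StandardBorelSpace Z] [Nonempty Z] {W : X → Z}
    (hW : Measurable W) (hπ : Measurable π) (hS : MeasurableEmbedding S) :
    condDistrib W π ν =ᵐ[ν.map π] (condDistrib W (S ∘ π) ν).comap S hS.measurable := by
  refine condDistrib_ae_eq_of_measure_eq_compProd π hW.aemeasurable ?_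
  set κ := condDistrib W (S ∘ π) ν
  have hSid : MeasurableEmbedding (Prod.map S (id : Z → Z)) := hS.prodMap .id
  refine hSid.map_injective ?_
  calc (ν.map fun x => (π x, W x)).map (Prod.map S id) = ν.map fun x => (S (π x), W x) := by
        rw [Measure.map_map hSid.measurable (hπ.prodMk hW)]
        rfl
    _ = (ν.map π).map S ⊗ₘ κ := by
        rw [Measure.map_map hS.measurable hπ, compProd_map_condDistrib hW.aemeasurable]
        rfl
    _ = (ν.map π ⊗ₘ κ.comap S hS.measurable).map (Prod.map S id) := by
        ext A hA
        rw [Measure.map_apply hSid.measurable hA, Measure.compProd_apply hA,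
          Measure.compProd_apply (hSid.measurable hA),
          lintegral_map (Kernel.measurable_kernel_prodMk_left hA) hS.measurable]
        rfl

variable [StandardBorelSpace X] [Nonempty X]

theorem condDistrib_apply_eq_map (hπ : Measurable π) (hT : MeasurePreserving T ν ν)
    (hS : MeasurableEmbedding S) (hπT : π ∘ T = S ∘ π) :
    ∀ᵐ x ∂ν, condDistrib id π ν (S (π x)) = (condDistrib id π ν (π x)).map T := by
  have hmap := condDistrib_map (ν := ν) (f := T) (X := π) (Y := id)
    hπ.aemeasurable aemeasurable_id hT.aemeasurable
  simp only [hT.map_eq, hπT, Function.id_comp] at hmap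
  filter_upwards [ae_of_ae_map (hS.measurable.comp hπ).aemeasurable hmap,
    ae_of_ae_map hπ.aemeasurable (condDistrib_ae_eq_comap (ν := ν) hT.measurable hπ hS),
    ae_of_ae_map hπ.aemeasurable (condDistrib_comp (μ := ν) π aemeasurable_id hT.measurable)]
    with x hx₁ hx₂ hx₃
  calc condDistrib id π ν (S (π x)) = condDistrib T (S ∘ π) ν (S (π x)) := hx₁
    _ = condDistrib T π ν (π x) := hx₂.symm
    _ = (condDistrib id π ν (π x)).map T := hx₃.trans (Kernel.map_apply _ hT.measurable _)

theorem ae_ae_condDistrib (hπ : Measurable π) {p : X → Prop} (hp : ∀ᵐ x ∂ν, p x) :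
    ∀ᵐ x ∂ν, ∀ᵐ y ∂condDistrib id π ν (π x), p y := by
  have hν : condDistrib id π ν ∘ₘ ν.map π = ν := by
    rw [condDistrib_comp_map hπ.aemeasurable aemeasurable_id, Measure.map_id]
  exact ae_of_ae_map hπ.aemeasurable (Measure.ae_ae_of_ae_comp (hν.symm ▸ hp))

theorem condDistrib_ae_mem_fibre [MeasurableEq Y] (hπ : Measurable π) :
    ∀ᵐ x ∂ν, ∀ᵐ y ∂condDistrib id π ν (π x), π y = π x := by
  refine ae_of_ae_map hπ.aemeasurable <| Measure.ae_ae_of_ae_compProd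
    (p := fun z : Y × X => π z.2 = z.1) ?_
  rw [compProd_map_condDistrib aemeasurable_id, ae_map_iff (by fun_prop)
    (measurableSet_eq_fun (by fun_prop) (by fun_prop))]
  exact ae_of_all _ fun x => rfl

theorem condDistrib_setOf_invariant [MeasurableEq Y] (hπ : Measurable π)
    (hT : MeasurePreserving T ν ν) (hS : MeasurableEmbedding S) (hπT : π ∘ T = S ∘ π)
    {r : X → X → Prop} (hr : MeasurableSet {p : X × X | r p.1 p.2})
    (hrT : ∀ x y, π x = π y → (r (T x) (T y) ↔ r x y)) :
    ∀ᵐ x ∂ν, condDistrib id π ν (π (T x)) {y | r (T x) y} =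
      condDistrib id π ν (π x) {y | r x y} := by
  filter_upwards [condDistrib_apply_eq_map hπ hT hS hπT, condDistrib_ae_mem_fibre (ν := ν) hπ]
    with x hx hfib
  calc condDistrib id π ν (π (T x)) {y | r (T x) y}
      = (condDistrib id π ν (π x)).map T {y | r (T x) y} := by
        rw [← hx, show π (T x) = S (π x) from congrFun hπT x]
    _ = condDistrib id π ν (π x) {y | r (T x) (T y)} :=
        Measure.map_apply hT.measurable (measurable_prodMk_left hr)
    _ = condDistrib id π ν (π x) {y | r x y} :=
        measure_congr (hfib.mono fun y hy => propext (hrT x y hy.symm))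

end ConditionalDistribution

theorem measure_setOf_measure_le_le {X : Type*} [MeasurableSpace X] (μ : Measure X)
    [IsFiniteMeasure μ] {h : X → ℝ} (hh : Measurable h) (c : ENNReal) :
    μ {x | μ {y | h y ≤ h x} ≤ c} ≤ c := by
  have hL : IsLowerSet {r | μ {y | h y ≤ r} ≤ c} := fun r s hsr hr =>
    (measure_mono fun y hy => le_trans hy hsr).trans hr
  have hLm := hL.ordConnected.measurableSet
  change μ (h ⁻¹' {r | μ {y | h y ≤ r} ≤ c}) ≤ c
  rw [← Measure.map_apply hh hLm, hLm.measure_eq_iSup_isCompact]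
  refine iSup₂_le fun C hC => iSup_le fun hCc => ?_
  rcases C.eq_empty_or_nonempty with rfl | hne
  · rw [measure_empty]
    exact zero_le
  · obtain ⟨a, ha, hmax⟩ := hCc.exists_isGreatest hne
    calc μ.map h C ≤ μ.map h (Iic a) := measure_mono fun x hx => hmax hx
      _ = μ {y | h y ≤ a} := Measure.map_apply hh measurableSet_Iic
      _ ≤ c := hC ha

/-- The flow `φ` on `X` extends the flow `ψ` on `Y` along `π`, with one-dimensional fibres: the
height `h` separates the points of a fibre, and `φ` preserves the order by height on fibres. -/
structure IsMonotoneExtension {X Y : Type*} [MeasurableSpace X] [MeasurableSpace Y]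
    (φ : ℝ → X → X) (ψ : ℝ → Y → Y) (π : X → Y) (h : X → ℝ) : Prop where
  flow : IsMeasurableFlow φ
  flow_base : IsMeasurableFlow ψ
  measurable_proj : Measurable π
  measurable_height : Measurable h
  proj_apply : ∀ t x, π (φ t x) = ψ t (π x)
  eq_of_height_eq : ∀ x y, π x = π y → h x = h y → x = y
  height_le_iff : ∀ t x y, π x = π y → (h (φ t x) ≤ h (φ t y) ↔ h x ≤ h y)

/-- A measurable section of the extension `π`, equivariant for the flows `φ` and `ψ`. For
`K ⊆ Ω × ℝ` over `Ω` these are the graphs in `K` of the Borel measurable equilibria. -/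
structure IsInvariantSection {X Y : Type*} [MeasurableSpace X] [MeasurableSpace Y]
    (φ : ℝ → X → X) (ψ : ℝ → Y → Y) (π : X → Y) (s : Y → X) : Prop where
  measurable : Measurable s
  proj : ∀ y, π (s y) = y
  apply : ∀ t y, s (ψ t y) = φ t (s y)

namespace IsMonotoneExtension

variable {X Y : Type*} [MeasurableSpace X] [StandardBorelSpace X] [MeasurableSpace Y]
  [MeasurableEq Y] {φ : ℝ → X → X} {ψ : ℝ → Y → Y} {π : X → Y} {h : X → ℝ}
  {ν : Measure X}

omit [StandardBorelSpace X] [MeasurableEq Y] in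
theorem neg (hE : IsMonotoneExtension φ ψ π h) : IsMonotoneExtension φ ψ π (-h) where
  __ := hE
  measurable_height := hE.measurable_height.neg
  eq_of_height_eq x y hxy hh := hE.eq_of_height_eq x y hxy (neg_injective hh)
  height_le_iff t x y hxy := by
    simpa only [Pi.neg_apply, neg_le_neg_iff] using hE.height_le_iff t y x hxy.symm

theorem ae_half_lt_condDistrib [Nonempty X] [IsFiniteMeasure ν] (hE : IsMonotoneExtension φ ψ π h)
    (hν : IsErgodicMeasure φ ν) :
    ∀ᵐ x ∂ν, 1 / 2 < condDistrib id π ν (π x) {y | h y ≤ h x} := by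
  have := hν.1
  have hr : MeasurableSet {p : X × X | h p.2 ≤ h p.1} :=
    measurableSet_le (hE.measurable_height.comp measurable_snd)
      (hE.measurable_height.comp measurable_fst)
  have hF : Measurable fun x => condDistrib id π ν (π x) {y | h y ≤ h x} :=
    Kernel.measurable_kernel_prodMk_left
      (κ := (condDistrib id π ν).comap π hE.measurable_proj) hr
  refine (hE.flow.ae_mem_or_ae_notMem hν (measurableSet_lt measurable_const hF)
    fun t => ?_).resolve_right fun hnot => ?_
  · filter_upwards [condDistrib_setOf_invariant hE.measurable_proj
      (hE.flow.measurePreserving hν t) (hE.flow_base.measurableEmbedding t)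
      (funext (hE.proj_apply t))
      (r := fun x y => h y ≤ h x) hr fun x y hxy => hE.height_le_iff t y x hxy.symm] with x hx
    exact iff_of_eq (congrArg (1 / 2 < ·) hx)
  obtain ⟨x, hx, hfib⟩ := ((ae_ae_condDistrib hE.measurable_proj hnot).and
    (condDistrib_ae_mem_fibre hE.measurable_proj)).exists
  set μ := condDistrib id π ν (π x)
  have hle : ∀ᵐ y ∂μ, y ∈ {y | μ {z | h z ≤ h y} ≤ 1 / 2} := by
    filter_upwards [hx, hfib] with y hy hyx
    rw [hyx] at hy
    exact not_lt.1 hy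
  have hone : μ {y | μ {z | h z ≤ h y} ≤ 1 / 2} = 1 :=
    (measure_congr (eventuallyEq_univ.2 hle)).trans measure_univ
  exact ((measure_setOf_measure_le_le μ hE.measurable_height (1 / 2)).trans_lt
    (ENNReal.half_lt_self one_ne_zero ENNReal.one_ne_top)).ne hone

-- Almost every point is a median, on its fibre, of the conditional measure: the mass weakly below
-- it and the mass weakly above it are both greater than `1/2`. A fibre has at most one such point.
theorem exists_ae_mem_injOn (hE : IsMonotoneExtension φ ψ π h) (hν : IsErgodicMeasure φ ν) :
    ∃ M, MeasurableSet M ∧ (∀ᵐ x ∂ν, x ∈ M) ∧ InjOn π M := by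
  have := hν.1
  have : Nonempty X := nonempty_of_isProbabilityMeasure ν
  let κ := condDistrib id π ν
  have hκ {r : X × X → Prop} (hr : MeasurableSet {p | r p}) :
      Measurable fun x => κ (π x) {y | r (x, y)} :=
    Kernel.measurable_kernel_prodMk_left (κ := κ.comap π hE.measurable_proj) hr
  have hh := hE.measurable_height
  refine ⟨{x | 1 / 2 < κ (π x) {y | h y ≤ h x}} ∩ {x | 1 / 2 < κ (π x) {y | (-h) y ≤ (-h) x}},
    (measurableSet_lt measurable_const (hκ (r := fun p => h p.2 ≤ h p.1) ?_)).inter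
      (measurableSet_lt measurable_const (hκ (r := fun p => (-h) p.2 ≤ (-h) p.1) ?_)),
    (hE.ae_half_lt_condDistrib hν).and (hE.neg.ae_half_lt_condDistrib hν),
    fun x hx y hy hxy => ?_⟩
  · exact measurableSet_le (hh.comp measurable_snd) (hh.comp measurable_fst)
  · exact measurableSet_le (hh.neg.comp measurable_snd) (hh.neg.comp measurable_fst)
  wlog hlt : h x < h y generalizing x y
  · rcases (not_lt.1 hlt).eq_or_lt with heq | hgt
    · exact (hE.eq_of_height_eq y x hxy.symm heq).symm
    · exact (this y hy x hx hxy.symm hgt).symm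
  have hdisj : Disjoint {z | h z ≤ h x} {z | (-h) z ≤ (-h) y} :=
    disjoint_left.2 fun z hzx hzy => (hlt.trans_le (neg_le_neg_iff.1 hzy)).not_ge hzx
  have := calc 1 / 2 + 1 / 2 < κ (π x) {z | h z ≤ h x} + κ (π x) {z | (-h) z ≤ (-h) y} :=
        ENNReal.add_lt_add hx.1 (hxy ▸ hy.2)
    _ = κ (π x) ({z | h z ≤ h x} ∪ {z | (-h) z ≤ (-h) y}) :=
        (measure_union hdisj (measurableSet_le hh.neg measurable_const)).symm
    _ ≤ 1 := prob_le_one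
  exact absurd (ENNReal.add_halves 1) this.ne

theorem exists_invariant_injOn (hE : IsMonotoneExtension φ ψ π h) (hν : IsErgodicMeasure φ ν) :
    ∃ C, MeasurableSet C ∧ (∀ᵐ x ∂ν, x ∈ C) ∧ (∀ t, ∀ x ∈ C, φ t x ∈ C) ∧ InjOn π C := by
  obtain ⟨M, hM, hMν, hinj⟩ := hE.exists_ae_mem_injOn hν
  refine ⟨orbitCore φ M, hE.flow.measurableSet_orbitCore hM, hE.flow.ae_mem_orbitCore hν hM hMν,
    fun t x => hE.flow.apply_mem_orbitCore t, fun x hx y hy hxy => ?_⟩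
  obtain ⟨t, hxt, hyt⟩ : ∃ t : ℝ, φ t x ∈ M ∧ φ t y ∈ M :=
    (show ∀ᵐ t : ℝ, φ t x ∈ M from hx).and hy |>.exists
  refine (hE.flow.measurableEmbedding t).injective (hinj hxt hyt ?_)
  rw [hE.proj_apply, hE.proj_apply, hxy]

omit [MeasurableEq Y] in
theorem exists_isInvariantSection [StandardBorelSpace Y] (hE : IsMonotoneExtension φ ψ π h)
    (hν : IsErgodicMeasure φ ν) {s₀ : Y → X} (hs₀ : IsInvariantSection φ ψ π s₀) :
    ∃ s, IsInvariantSection φ ψ π s ∧ (ν.map π).map s = ν := by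
  obtain ⟨C, hC, hCν, hφC, hinj⟩ := hE.exists_invariant_injOn hν
  have := hC.standardBorel
  let s : Y → X := Function.extend (fun x : C => π x) Subtype.val s₀
  have hsC {x : X} (hx : x ∈ C) : s (π x) = x :=
    (injOn_iff_injective.1 hinj).extend_apply Subtype.val s₀ ⟨x, hx⟩
  have hsC' {y : Y} (hy : y ∉ π '' C) : s y = s₀ y :=
    Function.extend_apply' _ _ _ fun ⟨x, hx⟩ => hy ⟨x, x.2, hx⟩
  have hs : Measurable s :=
    ((hE.measurable_proj.comp measurable_subtype_coe).measurableEmbedding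
      (injOn_iff_injective.1 hinj)).measurable_extend measurable_subtype_coe hs₀.measurable
  refine ⟨s, ⟨hs, fun y => ?_, fun t y => ?_⟩, ?_⟩
  · by_cases hy : y ∈ π '' C
    · obtain ⟨x, hx, rfl⟩ := hy
      rw [hsC hx]
    · rw [hsC' hy, hs₀.proj]
  · by_cases hy : y ∈ π '' C
    · obtain ⟨x, hx, rfl⟩ := hy
      rw [← hE.proj_apply, hsC (hφC t x hx), hsC hx]
    · have hy' : ψ t y ∉ π '' C := fun ⟨x, hx, hxy⟩ => hy
        ⟨φ (-t) x, hφC (-t) x hx, by rw [hE.proj_apply, hxy, hE.flow_base.neg_apply]⟩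
      rw [hsC' hy, hsC' hy', hs₀.apply]
  · calc (ν.map π).map s = ν.map (s ∘ π) := Measure.map_map hs hE.measurable_proj
      _ = ν.map id := Measure.map_congr (hCν.mono fun x hx => hsC hx)
      _ = ν := Measure.map_id

end IsMonotoneExtension

section Sections

variable {Ω : Type*} [MetricSpace Ω] [CompactSpace Ω] [MeasurableSpace Ω] [BorelSpace Ω]
  {σ : Flow ℝ Ω} {f : Ω × ℝ → ℝ} {m : Measure Ω} {K : Set (Ω × ℝ)}

/-- `s` maps `ω` to the point `(ω, β ω)` of `K`, for a Borel measurable equilibrium `β`. -/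
abbrev IsEquilibriumSection (hK : IsTauInvariant σ f K) (s : Ω → K) : Prop :=
  IsInvariantSection (tauOn hK) (fun t ω => σ t ω) (fun p : K => p.1.1) s

theorem isMeasurableFlow_base (σ : Flow ℝ Ω) : IsMeasurableFlow fun t ω => σ t ω where
  zero := σ.map_zero_apply
  add := σ.map_add
  measurable := σ.cont'.measurable

variable (hf : IsC01 f) (hKc : IsCompact K) (hK : IsTauInvariant σ f K)

include hf hKc in
theorem isMonotoneExtension_tauOn : IsMonotoneExtension (tauOn hK) (fun t ω => σ t ω)
    (fun p : K => p.1.1) (fun p : K => p.1.2) where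
  flow :=
    { zero := tauOn_zero hK hf
      add := tauOn_add hK hf
      measurable := measurable_uncurry_of_continuous_of_measurable (u := tauOn hK)
        (continuous_tauOn_time hK hf) fun t => (continuous_tauOn hK hf hKc t).measurable }
  flow_base := isMeasurableFlow_base σ
  measurable_proj := measurable_fst.comp measurable_subtype_coe
  measurable_height := measurable_snd.comp measurable_subtype_coe
  proj_apply _ _ := rfl
  eq_of_height_eq _ _ h₁ h₂ := Subtype.ext (Prod.ext h₁ h₂)
  height_le_iff t _ _ hpq := tauOn_snd_le_iff hK hf hpq t

omit [MeasurableSpace Ω] [BorelSpace Ω] [CompactSpace Ω] in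
include hKc in
theorem exists_highest_section (hKΩ : Prod.fst '' K = univ) :
    ∃ s : Ω → K, (∀ ω, (s ω).1.1 = ω) ∧ ∀ p : K, p.1.2 ≤ (s p.1.1).1.2 := by
  have : CompactSpace K := isCompact_iff_compactSpace.1 hKc
  have hmax (ω : Ω) : ∃ p : K, p.1.1 = ω ∧ ∀ q : K, q.1.1 = ω → q.1.2 ≤ p.1.2 := by
    have hc : IsCompact {p : K | p.1.1 = ω} :=
      (isClosed_eq (continuous_fst.comp continuous_subtype_val) continuous_const).isCompact
    obtain ⟨p, hp, hpω⟩ : ω ∈ Prod.fst '' K := hKΩ ▸ mem_univ ω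
    exact hc.exists_isMaxOn ⟨⟨p, hp⟩, hpω⟩ (continuous_snd.comp continuous_subtype_val).continuousOn
  choose s hs hsmax using hmax
  exact ⟨s, hs, fun p => hsmax _ p rfl⟩

omit [CompactSpace Ω] in
include hKc in
theorem measurable_of_highest_section {s : Ω → K} (hs : ∀ ω, (s ω).1.1 = ω)
    (hmax : ∀ p : K, p.1.2 ≤ (s p.1.1).1.2) : Measurable s := by
  have hheight : Measurable fun ω => (s ω).1.2 := by
    refine measurable_of_Ici fun c => ?_
    have : (fun ω => (s ω).1.2) ⁻¹' Ici c = Prod.fst '' (K ∩ Prod.snd ⁻¹' Ici c) := by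
      ext ω
      refine ⟨fun hω => ⟨(s ω).1, ⟨(s ω).2, hω⟩, hs ω⟩, ?_⟩
      rintro ⟨p, ⟨hp, hc⟩, rfl⟩
      exact le_trans hc (hmax ⟨p, hp⟩)
    rw [this]
    exact ((hKc.inter_right (isClosed_Ici.preimage continuous_snd)).image
      continuous_fst).measurableSet
  have hpair : (fun ω => (s ω).1) = fun ω => (ω, (s ω).1.2) :=
    funext fun ω => Prod.ext (hs ω) rfl
  exact Measurable.subtype_mk (hpair ▸ measurable_id.prodMk hheight)

include hf hKc in
theorem exists_isEquilibriumSection (hKΩ : Prod.fst '' K = univ) :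
    ∃ s, IsEquilibriumSection hK s := by
  have hE := isMonotoneExtension_tauOn hf hKc hK
  obtain ⟨s, hs, hmax⟩ := exists_highest_section hKc hKΩ
  have hproj (t : ℝ) (ω : Ω) : (tauOn hK t (s ω)).1.1 = σ t ω := congrArg (σ t) (hs ω)
  refine ⟨s, measurable_of_highest_section hKc hs hmax, hs, fun t ω => hE.eq_of_height_eq _ _
    ((hs _).trans (hproj t ω).symm) (le_antisymm ?_ (hproj t ω ▸ hmax (tauOn hK t (s ω))))⟩
  set q := tauOn hK (-t) (s (σ t ω)) with hq
  have hqω : q.1.1 = ω := (congrArg (σ (-t)) (hs (σ t ω))).trans (hE.flow_base.neg_apply t ω)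
  rw [← hE.flow.apply_neg t (s (σ t ω)), ← hq, tauOn_snd_le_iff hK hf (hqω.trans (hs ω).symm)]
  exact hqω ▸ hmax q

omit [CompactSpace Ω] in
theorem IsEquilibriumSection.represents {hK : IsTauInvariant σ f K} {s : Ω → K}
    (hs : IsEquilibriumSection hK s) (m : Measure Ω) :
    Represents σ f m (fun ω => (s ω).1.2) (m.map s) := by
  have hpt (ω : Ω) : (ω, (s ω).1.2) = (s ω).1 := Prod.ext (hs.proj ω).symm rfl
  refine ⟨fun ω t => ?_, ?_, fun ω => hpt ω ▸ (s ω).2, fun g hg => ?_⟩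
  · have h₁ := (hK (s ω) (s ω).2 t).1
    have h₂ := congrArg (fun p : K => p.1.2) (hs.apply t ω)
    rw [← hpt ω] at h₁
    refine ⟨h₁, h₂.trans ?_⟩
    change u σ f t (s ω).1.1 (s ω).1.2 = _
    rw [show (s ω).1.1 = ω from hs.proj ω]
  · exact (measurable_snd.comp (measurable_subtype_coe.comp hs.measurable)).nullMeasurable
  · simp only [hpt]
    exact integral_map hs.measurable.aemeasurable
      (hg.measurable.comp measurable_subtype_coe).aestronglyMeasurable

include hf hKc in
theorem exists_section_of_mem_ergodicMeasuresOver (hKΩ : Prod.fst '' K = univ) {ν : Measure K}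
    (hν : ν ∈ ergodicMeasuresOver hK m) : ∃ s, IsEquilibriumSection hK s ∧ m.map s = ν := by
  have := hKc.measurableSet.standardBorel
  obtain ⟨s₀, hs₀⟩ := exists_isEquilibriumSection hf hKc hK hKΩ
  obtain ⟨s, hs, hsν⟩ :=
    (isMonotoneExtension_tauOn hf hKc hK).exists_isInvariantSection hν.1 hs₀
  exact ⟨s, hs, hν.2 ▸ hsν⟩

end Sections

section Exponents

theorem integral_lt_integral_of_frequently_lt {X : Type*} [MeasurableSpace X] {μ : Measure X}
    {F G : X → ℝ} (hF : Integrable F μ) (hG : Integrable G μ) (hle : ∀ᵐ x ∂μ, F x ≤ G x)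
    (hlt : ∃ᵐ x ∂μ, F x < G x) : ∫ x, F x ∂μ < ∫ x, G x ∂μ := by
  refine lt_of_le_of_ne (integral_mono_ae hF hG hle) fun h => hlt ?_
  filter_upwards [(integral_eq_iff_of_ae_le hF hG hle).1 h] with x hx using hx.not_lt

theorem snd_mem_variationInterval {Ω : Type*} [TopologicalSpace Ω] {K : Set (Ω × ℝ)}
    (hKc : IsCompact K) (p : K) : p.1.2 ∈ variationInterval K :=
  have hc : IsCompact (Prod.snd '' K) := hKc.image continuous_snd
  ⟨csInf_le hc.bddBelow ⟨p.1, p.2, rfl⟩, le_csSup hc.bddAbove ⟨p.1, p.2, rfl⟩⟩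

theorem integrable_comp_of_compactSpace {Ω X : Type*} [MeasurableSpace Ω] {m : Measure Ω}
    [IsFiniteMeasure m] [TopologicalSpace X] [CompactSpace X] [MeasurableSpace X]
    [OpensMeasurableSpace X] {g : X → ℝ} (hg : Continuous g) {s : Ω → X} (hs : Measurable s) :
    Integrable (fun ω => g (s ω)) m :=
  (hg.integrable_of_hasCompactSupport (HasCompactSupport.of_compactSpace g)).comp_measurable hs

namespace IsEquilibriumSection

variable {Ω : Type*} [MetricSpace Ω] [CompactSpace Ω] [MeasurableSpace Ω] [BorelSpace Ω]
  {σ : Flow ℝ Ω} {f : Ω × ℝ → ℝ} {m : Measure Ω} {K : Set (Ω × ℝ)} {hK : IsTauInvariant σ f K}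
  {s s₁ s₂ : Ω → K} (hf : IsC01 f) (hKc : IsCompact K)
omit [CompactSpace Ω] [BorelSpace Ω] in
theorem measurable_height (hs : IsEquilibriumSection hK s) : Measurable fun ω => (s ω).1.2 :=
  measurable_snd.comp (measurable_subtype_coe.comp hs.measurable)

include hf hKc

omit [CompactSpace Ω] in
theorem integrable_fx [IsFiniteMeasure m] (hs : IsEquilibriumSection hK s) :
    Integrable (fun ω => fx f (ω, (s ω).1.2)) m := by
  have : CompactSpace K := isCompact_iff_compactSpace.1 hKc
  have := integrable_comp_of_compactSpace (m := m) (hf.2.2.comp continuous_subtype_val)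
    hs.measurable
  refine this.congr (ae_of_all _ fun ω => ?_)
  exact congrArg (fx f) (Prod.ext (hs.proj ω) rfl)

theorem integrable_segmentMean [IsFiniteMeasure m] (hs₁ : IsEquilibriumSection hK s₁)
    (hs₂ : IsEquilibriumSection hK s₂) :
    Integrable (fun ω => segmentMean (fun x => fx f (ω, x)) (s₁ ω).1.2 (s₂ ω).1.2) m := by
  have : CompactSpace K := isCompact_iff_compactSpace.1 hKc
  have hc : Continuous fun p : K × K => segmentMean (fun x => fx f (p.1.1.1, x)) p.1.1.2 p.2.1.2 :=
    hf.continuous_segmentMean (by fun_prop) (by fun_prop) (by fun_prop)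
  refine (integrable_comp_of_compactSpace hc (hs₁.measurable.prodMk hs₂.measurable)).congr
    (ae_of_all _ fun ω => ?_)
  simp only [hs₁.proj]

theorem integral_segmentMean_eq_zero (hm : IsErgodicMeasure (fun t ω => σ t ω) m)
    (hs₁ : IsEquilibriumSection hK s₁) (hs₂ : IsEquilibriumSection hK s₂)
    (hlt : ∀ᵐ ω ∂m, (s₁ ω).1.2 < (s₂ ω).1.2) :
    ∫ ω, segmentMean (fun x => fx f (ω, x)) (s₁ ω).1.2 (s₂ ω).1.2 ∂m = 0 := by
  have := hm.1
  refine (isMeasurableFlow_base σ).integral_eq_zero_of_additive_cocycle hm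
    (G := fun ω => Real.log ((s₂ ω).1.2 - (s₁ ω).1.2))
    (hs₂.measurable_height.sub hs₁.measurable_height).log.aestronglyMeasurable
    (integrable_segmentMean hf hKc hs₁ hs₂) ?_
  filter_upwards [hlt] with ω hω
  have hsub := tauOn_snd_sub hK hf ((hs₁.proj ω).trans (hs₂.proj ω).symm) 1
  simp only [← hs₁.apply, ← hs₂.apply, hs₁.proj ω] at hsub
  rw [hsub, Real.log_mul (sub_pos.2 hω).ne' (Real.exp_ne_zero _), Real.log_exp, add_sub_cancel_left]

omit [CompactSpace Ω] hKc in
theorem lyapunov_map (hs : IsEquilibriumSection hK s) :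
    lyapunov f (m.map s) = ∫ ω, fx f (ω, (s ω).1.2) ∂m :=
  (hs.represents m).2.2.2 _ hf.2.2

theorem lyapunov_signs (hm : IsErgodicMeasure (fun t ω => σ t ω) m)
    (hconc : ∀ᵐ ω ∂m, ConcaveOn ℝ (variationInterval K) fun x => fx f (ω, x))
    (hstrict : ∃ᵐ ω ∂m, StrictConcaveOn ℝ (variationInterval K) fun x => fx f (ω, x))
    (hs₁ : IsEquilibriumSection hK s₁) (hs₂ : IsEquilibriumSection hK s₂)
    (hs₃ : IsEquilibriumSection hK s₃) (h₁₂ : ∀ᵐ ω ∂m, (s₁ ω).1.2 < (s₂ ω).1.2)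
    (h₂₃ : ∀ᵐ ω ∂m, (s₂ ω).1.2 < (s₃ ω).1.2) :
    lyapunov f (m.map s₁) < 0 ∧ 0 < lyapunov f (m.map s₂) ∧ lyapunov f (m.map s₃) < 0 := by
  have := hm.1
  have h₁₃ : ∀ᵐ ω ∂m, (s₁ ω).1.2 < (s₃ ω).1.2 := by
    filter_upwards [h₁₂, h₂₃] with ω h h' using h.trans h'
  have hmem (p : K) := snd_mem_variationInterval hKc p
  have hcont (ω : Ω) : Continuous fun x => fx f (ω, x) := hf.2.2.comp (by fun_prop)
  have hle := (hconc.and (h₁₂.and h₂₃)).mono fun ω h =>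
    segmentMean_triple_le h.1 (hcont ω) (hmem _) (hmem _) (hmem _) h.2.1.le h.2.2.le
  have hlt := (hstrict.and_eventually (h₁₂.and h₂₃)).mono fun ω h =>
    segmentMean_triple_lt h.1 (hcont ω) (hmem _) (hmem _) (hmem _) h.2.1 h.2.2
  have i₁ := integrable_fx hf hKc (m := m) hs₁
  have i₂ := integrable_fx hf hKc (m := m) hs₂
  have i₃ := integrable_fx hf hKc (m := m) hs₃
  have i₁₂ := integrable_segmentMean hf hKc (m := m) hs₁ hs₂
  have i₁₃ := integrable_segmentMean hf hKc (m := m) hs₁ hs₃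
  have i₂₃ := integrable_segmentMean hf hKc (m := m) hs₂ hs₃
  have z₁₂ := integral_segmentMean_eq_zero hf hKc hm hs₁ hs₂ h₁₂
  have z₁₃ := integral_segmentMean_eq_zero hf hKc hm hs₁ hs₃ h₁₃
  have z₂₃ := integral_segmentMean_eq_zero hf hKc hm hs₂ hs₃ h₂₃
  simp only [lyapunov_map hf hs₁, lyapunov_map hf hs₂, lyapunov_map hf hs₃]
  refine ⟨?_, ?_, ?_⟩
  · have := integral_lt_integral_of_frequently_lt (i₁.add i₂₃) (i₁₂.add i₁₃)
      (hle.mono fun ω h => h.1) (hlt.mono fun ω h => h.1)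
    simpa only [integral_add' i₁ i₂₃, integral_add' i₁₂ i₁₃, z₁₂, z₁₃, z₂₃, add_zero] using this
  · have := integral_lt_integral_of_frequently_lt (i₁₂.add i₂₃) (i₂.add i₁₃)
      (hle.mono fun ω h => h.2.1) (hlt.mono fun ω h => h.2.1)
    simpa only [integral_add' i₁₂ i₂₃, integral_add' i₂ i₁₃, z₁₂, z₁₃, z₂₃, add_zero] using this
  · have := integral_lt_integral_of_frequently_lt (i₁₂.add i₃) (i₁₃.add i₂₃)
      (hle.mono fun ω h => h.2.2) (hlt.mono fun ω h => h.2.2)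
    simpa only [integral_add' i₁₂ i₃, integral_add' i₁₃ i₂₃, z₁₂, z₁₃, z₂₃, zero_add] using this

end IsEquilibriumSection

end Exponents

section StrictConcavity

theorem strictConcaveOn_of_second_difference_pos {S : Set ℝ} {h : ℝ → ℝ} (hh : ConcaveOn ℝ S h)
    (hpos : ∃ᶠ δ in 𝓝[>] 0, ∀ x, Icc (x - δ / 2) (x + δ / 2) ⊆ S →
      0 < 2 * h x - h (x - δ / 2) - h (x + δ / 2)) : StrictConcaveOn ℝ S h := by
  refine LinearOrder.strictConcaveOn_of_lt hh.1 fun x hx y hy hxy a b ha hb hab => ?_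
  simp only [smul_eq_mul]
  have hyx : 0 < y - x := sub_pos.2 hxy
  obtain ⟨δ, hδ, hδ₀, hδlt⟩ := (hpos.and_eventually
    (Ioo_mem_nhdsGT (mul_pos (mul_pos two_pos (lt_min ha hb)) hyx))).exists
  obtain ⟨η, hη⟩ : ∃ η, δ / 2 = η * (y - x) := ⟨_, (div_mul_cancel₀ _ hyx.ne').symm⟩
  have hη₀ : 0 < η := pos_of_mul_pos_left (hη ▸ half_pos hδ₀) hyx.le
  have hηlt : η < min a b := by
    refine lt_of_mul_lt_mul_right ?_ hyx.le
    linarith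
  have hηa : η < a := hηlt.trans_le (min_le_left a b)
  have hηb : η < b := hηlt.trans_le (min_le_right a b)
  have hleft : (a + η) * x + (b - η) * y = a * x + b * y - δ / 2 := by rw [hη]; ring
  have hright : (a - η) * x + (b + η) * y = a * x + b * y + δ / 2 := by rw [hη]; ring
  have ha₁ : 0 ≤ a + η := by linarith
  have hb₁ : 0 ≤ b - η := by linarith
  have ha₂ : 0 ≤ a - η := by linarith
  have hb₂ : 0 ≤ b + η := by linarith
  have hl := hh.2 hx hy ha₁ hb₁ (by linarith)
  have hr := hh.2 hx hy ha₂ hb₂ (by linarith)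
  have hmeml := hh.1 hx hy ha₁ hb₁ (by linarith)
  have hmemr := hh.1 hx hy ha₂ hb₂ (by linarith)
  simp only [smul_eq_mul, hleft, hright] at hl hr hmeml hmemr
  have := hδ _ (hh.1.ordConnected.out hmeml hmemr)
  linarith

theorem frequently_ae_frequently_mem {X : Type*} [MeasurableSpace X] {μ : Measure X}
    [IsFiniteMeasure μ] {A : ℕ → Set X} (hA : ∀ n, MeasurableSet (A n)) {c : ENNReal} (hc : 0 < c)
    (hcA : ∀ n, c ≤ μ (A n)) : ∃ᵐ x ∂μ, ∃ᶠ n in atTop, x ∈ A n := by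
  intro h
  have hlim : Tendsto (fun n => μ (A n)) atTop (𝓝 (μ ∅)) := by
    refine tendsto_measure_of_ae_tendsto_indicator_of_isFiniteMeasure atTop .empty hA ?_
    filter_upwards [h] with x hx
    filter_upwards [not_frequently.1 hx] with n hn using iff_of_false hn (notMem_empty x)
  rw [measure_empty] at hlim
  exact hc.not_ge (ge_of_tendsto' hlim hcA)

section

variable {Ω : Type*} {f : Ω × ℝ → ℝ}

theorem second_difference_pos_of_stdModule_pos {J : Set ℝ} {δ : ℝ} {ω : Ω}
    (hconc : ConcaveOn ℝ J fun x => fx f (ω, x)) (hδ : 0 < δ) (h : 0 < stdModule f J δ ω) {x : ℝ}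
    (hx : Icc (x - δ / 2) (x + δ / 2) ⊆ J) :
    0 < 2 * fx f (ω, x) - fx f (ω, x - δ / 2) - fx f (ω, x + δ / 2) := by
  have hinf := pos_of_mul_pos_right h (by positivity)
  refine hinf.trans_le (csInf_le ⟨0, ?_⟩ ⟨x, hx, rfl⟩)
  rintro _ ⟨y, hy, rfl⟩
  have hmid := hconc.2 (hy (left_mem_Icc.2 (by linarith))) (hy (right_mem_Icc.2 (by linarith)))
    one_half_pos.le one_half_pos.le (add_halves 1)
  simp only [smul_eq_mul] at hmid
  rw [show 1 / 2 * (y - δ / 2) + 1 / 2 * (y + δ / 2) = y by ring] at hmid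
  linarith

theorem continuous_stdModule [TopologicalSpace Ω] (hf : IsC01 f) {a b δ : ℝ} (hδ : 0 ≤ δ) :
    Continuous (stdModule f (Icc a b) δ) := by
  have hset : {x : ℝ | Icc (x - δ / 2) (x + δ / 2) ⊆ Icc a b} = Icc (a + δ / 2) (b - δ / 2) := by
    ext x
    rw [mem_ofPred_eq, Icc_subset_Icc_iff (by linarith), mem_Icc, le_sub_iff_add_le,
      le_sub_iff_add_le]
  unfold stdModule
  simp only [hset]
  have hfx := hf.2.2
  exact continuous_const.mul (isCompact_Icc.continuous_sInf (by fun_prop))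

theorem IsSDCOn.frequently_strictConcaveOn [TopologicalSpace Ω] [MeasurableSpace Ω]
    [OpensMeasurableSpace Ω] {m : Measure Ω} [IsProbabilityMeasure m] (hf : IsC01 f) {a b : ℝ}
    (h : IsSDCOn f m (Icc a b)) :
    ∃ᵐ ω ∂m, StrictConcaveOn ℝ (Icc a b) fun x => fx f (ω, x) := by
  obtain ⟨hdc, ρ, hρ, hmeas⟩ := h
  have hconc (ω : Ω) := (hdc ω).subset (subset_univ (Icc a b)) (convex_Icc a b)
  obtain hba | hab := le_or_gt b a
  · refine Frequently.of_forall fun ω => ⟨convex_Icc a b, fun x hx y hy hxy => ?_⟩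
    exact absurd (subsingleton_Icc_of_ge hba hx hy) hxy
  have hlen : 0 < len (Icc a b) / 2 := by
    rw [len, csSup_Icc hab.le, csInf_Icc hab.le]
    linarith
  obtain ⟨δ, -, hδ, hδlim⟩ := exists_seq_strictAnti_tendsto' hlen
  have hδ' : Tendsto δ atTop (𝓝[>] 0) :=
    tendsto_nhdsWithin_iff.2 ⟨hδlim, .of_forall fun n => (hδ n).1⟩
  refine (frequently_ae_frequently_mem (A := fun n => {ω | 0 < stdModule f (Icc a b) (δ n) ω})
    (fun n => (isOpen_lt continuous_const (continuous_stdModule hf (hδ n).1.le)).measurableSet)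
    (ENNReal.ofReal_pos.2 hρ) fun n => (hmeas _ (hδ n).1 (hδ n).2.le).le).mono fun ω hω => ?_
  exact strictConcaveOn_of_second_difference_pos (hconc ω) (hδ'.frequently (hω.mono fun n hn x hx =>
    second_difference_pos_of_stdModule_pos (hconc ω) (hδ n).1 hn hx))

end

end StrictConcavity

section Counting

theorem exists_strictMono_family {α : Type*} {E : Set α} {I : α → ℝ} (hI : InjOn I E) {n : ℕ}
    (hn : n ≤ E.encard) : ∃ e : Fin n → α, (∀ i, e i ∈ E) ∧ StrictMono fun i => I (e i) := by
  obtain ⟨T, hTE, hT⟩ := exists_subset_encard_eq hn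
  have hTI : (I '' T).encard = n := by rw [(hI.mono hTE).encard_image, hT]
  have hfin : (I '' T).Finite := finite_of_encard_eq_coe hTI
  have hcard : hfin.toFinset.card = n := by
    rw [hfin.encard_eq_coe_toFinset_card] at hTI
    exact_mod_cast hTI
  have hmem (i : Fin n) : hfin.toFinset.orderEmbOfFin hcard i ∈ I '' T :=
    hfin.mem_toFinset.1 (Finset.orderEmbOfFin_mem _ hcard i)
  choose e heT heI using hmem
  refine ⟨e, fun i => hTE (heT i), ?_⟩
  simp only [heI]
  exact (hfin.toFinset.orderEmbOfFin hcard).strictMono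

theorem range_eq_of_injective_of_encard_eq {α : Type*} {E : Set α} {n : ℕ} {e : Fin n → α}
    (he : Function.Injective e) (heE : ∀ i, e i ∈ E) (hE : E.encard = n) : range e = E := by
  refine (finite_range e).eq_of_subset_of_encard_le (range_subset_iff.2 heE) ?_
  rw [hE, ← image_univ, he.encard_image, encard_univ, ENat.card_eq_coe_fintype_card,
    Fintype.card_fin]

variable {Ω : Type*} [MetricSpace Ω] [CompactSpace Ω] [MeasurableSpace Ω] [BorelSpace Ω]
  {σ : Flow ℝ Ω} {f : Ω × ℝ → ℝ} {m : Measure Ω} {K : Set (Ω × ℝ)} {hK : IsTauInvariant σ f K}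
  {s s₁ s₂ : Ω → K}

namespace IsEquilibriumSection

omit [CompactSpace Ω] in
theorem integral_snd_map (hs : IsEquilibriumSection hK s) :
    ∫ p : K, p.1.2 ∂(m.map s) = ∫ ω, (s ω).1.2 ∂m :=
  (hs.represents m).2.2.2 _ continuous_snd

omit [CompactSpace Ω] in
theorem integrable_height (hKc : IsCompact K) [IsFiniteMeasure m]
    (hs : IsEquilibriumSection hK s) : Integrable (fun ω => (s ω).1.2) m :=
  have : CompactSpace K := isCompact_iff_compactSpace.1 hKc
  integrable_comp_of_compactSpace (continuous_snd.comp continuous_subtype_val) hs.measurable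

theorem ae_lt_or_ae_le (hf : IsC01 f) (hm : IsErgodicMeasure (fun t ω => σ t ω) m)
    (hs₁ : IsEquilibriumSection hK s₁) (hs₂ : IsEquilibriumSection hK s₂) :
    (∀ᵐ ω ∂m, (s₁ ω).1.2 < (s₂ ω).1.2) ∨ ∀ᵐ ω ∂m, (s₂ ω).1.2 ≤ (s₁ ω).1.2 := by
  have := (isMeasurableFlow_base σ).ae_mem_or_ae_notMem hm
    (measurableSet_lt hs₁.measurable_height hs₂.measurable_height) fun t => ae_of_all _ fun ω => by
      have hle := tauOn_snd_le_iff hK hf ((hs₂.proj ω).trans (hs₁.proj ω).symm) t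
      rw [← hs₁.apply, ← hs₂.apply] at hle
      exact not_le.symm.trans ((not_congr hle).trans not_le)
  exact this.imp_right fun h => h.mono fun ω hω => not_lt.1 hω

theorem ae_lt_of_integral_lt (hf : IsC01 f) (hKc : IsCompact K)
    (hm : IsErgodicMeasure (fun t ω => σ t ω) m)
    (hs₁ : IsEquilibriumSection hK s₁) (hs₂ : IsEquilibriumSection hK s₂)
    (h : ∫ p : K, p.1.2 ∂(m.map s₁) < ∫ p : K, p.1.2 ∂(m.map s₂)) :
    ∀ᵐ ω ∂m, (s₁ ω).1.2 < (s₂ ω).1.2 := by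
  have := hm.1
  refine (ae_lt_or_ae_le hf hm hs₁ hs₂).resolve_right fun hle => h.not_ge ?_
  rw [hs₁.integral_snd_map, hs₂.integral_snd_map]
  exact integral_mono_ae (hs₂.integrable_height hKc) (hs₁.integrable_height hKc) hle

theorem ae_le_of_integral_le (hf : IsC01 f) (hKc : IsCompact K)
    (hm : IsErgodicMeasure (fun t ω => σ t ω) m)
    (hs₁ : IsEquilibriumSection hK s₁) (hs₂ : IsEquilibriumSection hK s₂)
    (h : ∫ p : K, p.1.2 ∂(m.map s₁) ≤ ∫ p : K, p.1.2 ∂(m.map s₂)) :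
    ∀ᵐ ω ∂m, (s₁ ω).1.2 ≤ (s₂ ω).1.2 := by
  have := hm.1
  refine (ae_lt_or_ae_le hf hm hs₂ hs₁).resolve_left fun hlt => h.not_gt ?_
  rw [hs₁.integral_snd_map, hs₂.integral_snd_map]
  exact integral_lt_integral_of_frequently_lt (hs₂.integrable_height hKc)
    (hs₁.integrable_height hKc) (hlt.mono fun ω => le_of_lt) hlt.frequently

theorem map_eq_of_integral_eq (hf : IsC01 f) (hKc : IsCompact K)
    (hm : IsErgodicMeasure (fun t ω => σ t ω) m)
    (hs₁ : IsEquilibriumSection hK s₁) (hs₂ : IsEquilibriumSection hK s₂)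
    (h : ∫ p : K, p.1.2 ∂(m.map s₁) = ∫ p : K, p.1.2 ∂(m.map s₂)) : m.map s₁ = m.map s₂ := by
  refine Measure.map_congr ?_
  filter_upwards [ae_le_of_integral_le hf hKc hm hs₁ hs₂ h.le,
    ae_le_of_integral_le hf hKc hm hs₂ hs₁ h.ge] with ω hle hge
  exact Subtype.ext (Prod.ext ((hs₁.proj ω).trans (hs₂.proj ω).symm) (le_antisymm hle hge))

end IsEquilibriumSection

theorem exists_ordered_sections (hf : IsC01 f) (hm : IsErgodicMeasure (fun t ω => σ t ω) m)
    (hKc : IsCompact K) (hK : IsTauInvariant σ f K) (hKΩ : Prod.fst '' K = univ) {n : ℕ}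
    (hn : n ≤ (ergodicMeasuresOver hK m).encard) :
    ∃ s : Fin n → Ω → K, (∀ i, IsEquilibriumSection hK (s i)) ∧
      (∀ i, m.map (s i) ∈ ergodicMeasuresOver hK m) ∧
      (Function.Injective fun i => m.map (s i)) ∧
      ∀ i j, i < j → ∀ᵐ ω ∂m, (s i ω).1.2 < (s j ω).1.2 := by
  have hsec (ν : Measure K) (hν : ν ∈ ergodicMeasuresOver hK m) :=
    exists_section_of_mem_ergodicMeasuresOver hf hKc hK hKΩ hν
  choose s hs hsν using hsec
  have hinj : InjOn (fun ν : Measure K => ∫ p : K, p.1.2 ∂ν) (ergodicMeasuresOver hK m) := by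
    intro ν hν ν' hν' h
    rw [← hsν ν hν, ← hsν ν' hν']
    refine (hs ν hν).map_eq_of_integral_eq hf hKc hm (hs ν' hν') ?_
    rwa [hsν ν hν, hsν ν' hν']
  obtain ⟨e, he, hmono⟩ := exists_strictMono_family hinj hn
  have hmap (i : Fin n) : m.map (s (e i) (he i)) = e i := hsν _ (he i)
  refine ⟨fun i => s (e i) (he i), fun i => hs _ (he i), ?_, ?_, fun i j hij => ?_⟩
  · simpa only [hmap] using he
  · simp only [hmap]
    exact fun i j hij => hmono.injective (congrArg (fun ν : Measure K => ∫ p : K, p.1.2 ∂ν) hij)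
  · refine (hs _ (he i)).ae_lt_of_integral_lt hf hKc hm (hs _ (he j)) ?_
    rw [hmap i, hmap j]
    exact hmono hij

end Counting

end SkewFlow

theorem theorem4p1_general {Ω : Type*} [MetricSpace Ω] [CompactSpace Ω] [MeasurableSpace Ω]
    [BorelSpace Ω] (σ : Flow ℝ Ω) (f : Ω × ℝ → ℝ) (hf : SkewFlow.IsC01 f)
    (m : Measure Ω) (hm : SkewFlow.IsErgodicMeasure (fun t ω => σ t ω) m)
    (K : Set (Ω × ℝ)) (hKc : IsCompact K) (hK : SkewFlow.IsTauInvariant σ f K)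
    (hKΩ : Prod.fst '' K = univ)
    (hconc : ∀ᵐ ω ∂m, ConcaveOn ℝ (SkewFlow.variationInterval K) fun x => SkewFlow.fx f (ω, x))
    (hstrict : ∃ᵐ ω ∂m,
      StrictConcaveOn ℝ (SkewFlow.variationInterval K) fun x => SkewFlow.fx f (ω, x)) :
    (SkewFlow.ergodicMeasuresOver hK m).encard ≤ 3 ∧
    ((SkewFlow.ergodicMeasuresOver hK m).encard = 3 →
      ∃ (ν₁ ν₂ ν₃ : Measure K) (β₁ β₂ β₃ : Ω → ℝ),
        SkewFlow.ergodicMeasuresOver hK m = {ν₁, ν₂, ν₃} ∧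
        SkewFlow.Represents σ f m β₁ ν₁ ∧
        SkewFlow.Represents σ f m β₂ ν₂ ∧
        SkewFlow.Represents σ f m β₃ ν₃ ∧
        (∀ᵐ ω ∂m, β₁ ω < β₂ ω ∧ β₂ ω < β₃ ω) ∧
        SkewFlow.lyapunov f ν₁ < 0 ∧
        0 < SkewFlow.lyapunov f ν₂ ∧
        SkewFlow.lyapunov f ν₃ < 0) := by
  refine ⟨?_, fun hcard => ?_⟩
  · by_contra! hcard
    obtain ⟨s, hs, -, -, hlt⟩ := SkewFlow.exists_ordered_sections hf hm hKc hK hKΩ (n := 4)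
      (Order.add_one_le_of_lt hcard)
    have hpos := SkewFlow.IsEquilibriumSection.lyapunov_signs hf hKc hm hconc hstrict
      (hs 0) (hs 1) (hs 2) (hlt 0 1 (by decide)) (hlt 1 2 (by decide))
    have hneg := SkewFlow.IsEquilibriumSection.lyapunov_signs hf hKc hm hconc hstrict
      (hs 1) (hs 2) (hs 3) (hlt 1 2 (by decide)) (hlt 2 3 (by decide))
    exact lt_asymm hpos.2.1 hneg.1
  · obtain ⟨s, hs, hsE, hinj, hlt⟩ :=
      SkewFlow.exists_ordered_sections hf hm hKc hK hKΩ (n := 3) hcard.ge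
    have h₁₂ := hlt 0 1 (by decide)
    have h₂₃ := hlt 1 2 (by decide)
    refine ⟨_, _, _, _, _, _, ?_, (hs 0).represents m, (hs 1).represents m, (hs 2).represents m,
      h₁₂.and h₂₃, SkewFlow.IsEquilibriumSection.lyapunov_signs hf hKc hm hconc hstrict
        (hs 0) (hs 1) (hs 2) h₁₂ h₂₃⟩
    rw [← SkewFlow.range_eq_of_injective_of_encard_eq hinj hsE hcard]
    ext ν
    simp [Fin.exists_fin_succ, eq_comm]

theorem theorem4p1 {Ω : Type*} [MetricSpace Ω] [CompactSpace Ω] [MeasurableSpace Ω] [BorelSpace Ω]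
    (σ : Flow ℝ Ω) (f : Ω × ℝ → ℝ) (hf : SkewFlow.IsC01 f)
    (m : Measure Ω) (hm : SkewFlow.IsErgodicMeasure (fun t ω => σ t ω) m)
    (K : Set (Ω × ℝ)) (hKc : IsCompact K) (hK : SkewFlow.IsTauInvariant σ f K)
    (hKΩ : Prod.fst '' K = univ)
    (hSDC : SkewFlow.IsSDCOn f m (SkewFlow.variationInterval K)) :
    (SkewFlow.ergodicMeasuresOver hK m).encard ≤ 3 ∧
    ((SkewFlow.ergodicMeasuresOver hK m).encard = 3 →
      ∃ (ν₁ ν₂ ν₃ : Measure K) (β₁ β₂ β₃ : Ω → ℝ),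
        SkewFlow.ergodicMeasuresOver hK m = {ν₁, ν₂, ν₃} ∧
        SkewFlow.Represents σ f m β₁ ν₁ ∧
        SkewFlow.Represents σ f m β₂ ν₂ ∧
        SkewFlow.Represents σ f m β₃ ν₃ ∧
        (∀ᵐ ω ∂m, β₁ ω < β₂ ω ∧ β₂ ω < β₃ ω) ∧
        SkewFlow.lyapunov f ν₁ < 0 ∧
        0 < SkewFlow.lyapunov f ν₂ ∧
        SkewFlow.lyapunov f ν₃ < 0) :=
  have := hm.1
  theorem4p1_general σ f hf m hm K hKc hK hKΩ
    (ae_of_all _ fun ω => (hSDC.1 ω).subset (subset_univ _) (convex_Icc _ _))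
    (hSDC.frequently_strictConcaveOn hf)
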